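/- Let $R$ be a commutative ring with $1$, let $m\ge 1$ and $r\ge 0$ be integers, let $q\in R$ be invertible and $u_1,\dots,u_m\in R$. The Ariki--Koike algebra $\mathbf H$ is the associative unital $R$-algebra with generators $T_0,T_1,\dots,T_{r-1}$ and relations $T_0T_1T_0T_1=T_1T_0T_1T_0$; $T_iT_{i+1}T_i=T_{i+1}T_iT_{i+1}$ for $1\le i\le r-2$; $T_iT_j=T_jT_i$ for $|i-j|\ge 2$; $(T_i-q)(T_i+1)=0$ for $i\ne 0$; $(T_0-u_1)\cdots(T_0-u_m)=0$. Put $L_1=T_0$ and $L_i=q^{-1}T_{i-1}L_{i-1}T_{i-1}$ for $2\le i\le r$. Let $\mathfrak S_r$ be the symmetric group on $\{1,\dots,r\}$, acting from the right, with basic transpositions $s_i=(i,i+1)$, and let $T_w=T_{i_1}\cdots T_{i_k}$ for a reduced expression $w=s_{i_1}\cdots s_{i_k}$. Let $\mathcal H$ be the subalgebra of $\mathbf H$ generated by $T_1,\dots,T_{r-1}$; for a subgroup $P$ of $\mathfrak S_r$ generated by basic transpositions let $\mathcal H(P)$ be the subalgebra generated by the $T_i$ with $s_i\in P$. For $1\le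 i\le r$, $\mathfrak S_i\le\mathfrak S_r$ is the symmetric group on $\{1,\dots,i\}$. Let $\Lambda[m,r]$ be the set of integer sequences $\mathbf a=[a_0,\dots,a_m]$ with $0=a_0\le a_1\le\cdots\le a_m=r$. For such $\mathbf a$ let $\mathbf a'=[0,r-a_{m-1},\dots,r-a_1,r]$; let $\mathfrak S_{\mathbf a}$ be the Young subgroup of permutations preserving each block $\{a_{j-1}+1,\dots,a_j\}$; and let $w_{\mathbf a}\in\mathfrak S_r$ be given by $(a_{j-1}+l)w_{\mathbf a}=r-a_j+l$ for $1\le j\le m$ and $1\le l\le a_j-a_{j-1}$. With $\pi_c(x)=\prod_{j=1}^{c}(L_j-x)$ (so $\pi_0(x)=1$), put $$\pi_{\mathbf a}=\pi_{a_1}(u_2)\cdots\pi_{a_{m-1}}(u_m),\qquad \tilde\pi_{\mathbf a}=\pi_{a_1}(u_{m-1})\cdots\pi_{a_{m-1}}(u_1),\qquad v_{\mathbf a}=\pi_{\mathbf a}T_{w_{\mathbf a}}\tilde\pi_{\mathbf a'}.$$ Then for every $\mathbf a\in\Lambda[m,r]$: (a) $\pi_{\mathbf a}\mathcal H\tilde\pi_{\mathbf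 a'}=v_{\mathbf a}\mathcal H(\mathfrak S_{\mathbf a'})=\mathcal H(\mathfrak S_{\mathbf a})v_{\mathbf a}$, and $v_{\mathbf a}T_i=T_{(i)w_{\mathbf a}^{-1}}v_{\mathbf a}$ for every $s_i\in\mathfrak S_{\mathbf a'}$. (b) For every $i=1,\dots,r$, $v_{\mathbf a}L_i\in v_{\mathbf a}\mathcal H(\mathfrak S_i)\cap v_{\mathbf a}\mathcal H(\mathfrak S_{\mathbf a'})$ and $L_iv_{\mathbf a}\in\mathcal H(\mathfrak S_i)v_{\mathbf a}\cap\mathcal H(\mathfrak S_{\mathbf a})v_{\mathbf a}$. In particular, $v_{\mathbf a}L_i=u_jv_{\mathbf a}$ if $i=r-a_j+1$ for some $j\in\{1,\dots,m\}$ with $a_{j-1}<a_j$. (c) $\pi_{\mathbf a}\mathbf H\tilde\pi_{\mathbf a'}=\pi_{\mathbf a}\mathcal H\tilde\pi_{\mathbf a'}$. (d) $v_{\mathbf a}\mathbf H=v_{\mathbf a}\mathcal H$. -/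

import Mathlib

namespace ArikiKoike

/-! ### The symmetric groups

Permutations of `{1, …, n}` are regarded as permutations of `ℕ` fixing everything outside
`{1, …, n}`, so that the symmetric groups on `{1, …, n}` form an increasing chain.
Permutations are written on the right in the source: `(x)w` is `w x` here, and the product of
`w` and `v` acting from the right (first `w`, then `v`) is `v * w` here. -/

/-- The symmetric group on `{1, …, n}`. -/
def sym (n : ℕ) : Subgroup (Equiv.Perm ℕ) where
  carrier := {w | ∀ x, x ∉ Set.Icc 1 n → w x = x}
  mul_mem' := by
    intro v w hv hw x hx
    rw [Equiv.Perm.mul_apply, hw x hx, hv x hx]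
  one_mem' := fun _ _ => rfl
  inv_mem' := by
    intro w hw x hx
    rw [Equiv.Perm.inv_eq_iff_eq, hw x hx]

/-- The basic transposition `s_i = (i, i+1)`. -/
def s (i : ℕ) : Equiv.Perm ℕ := Equiv.swap i (i + 1)

/-- The product `s_{i₁} s_{i₂} ⋯ s_{i_k}` of permutations acting from the right: first `s_{i₁}`
is applied, then `s_{i₂}`, and so on. -/
def wordPerm (l : List ℕ) : Equiv.Perm ℕ := (l.map s).reverse.prod

/-- `l = [i₁, …, i_k]` is an expression of `w` as a product `s_{i₁} ⋯ s_{i_k}` of basic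
transpositions in the symmetric group on `{1, …, r}`. -/
def IsExpression (r : ℕ) (w : Equiv.Perm ℕ) (l : List ℕ) : Prop :=
  (∀ i ∈ l, 1 ≤ i ∧ i < r) ∧ wordPerm l = w

/-- A reduced expression: an expression of minimal length. -/
def IsReduced (r : ℕ) (w : Equiv.Perm ℕ) (l : List ℕ) : Prop :=
  IsExpression r w l ∧ ∀ l', IsExpression r w l' → l.length ≤ l'.length

theorem s_mem_sym {n i : ℕ} (h1 : 1 ≤ i) (h2 : i < n) : s i ∈ sym n := by
  intro x hx
  simp only [Set.mem_Icc, not_and, not_le] at hx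
  apply Equiv.swap_apply_of_ne_of_ne <;> (rintro rfl; omega)

theorem exists_expression (r : ℕ) :
    ∀ w : Equiv.Perm ℕ, w ∈ sym r → ∃ l, IsExpression r w l := by
  induction r with
  | zero =>
    intro w hw
    refine ⟨[], by simp, ?_⟩
    ext x
    have := hw x (by simp only [Set.mem_Icc]; omega)
    simp [wordPerm, this]
  | succ r ih =>
    suffices H : ∀ d : ℕ, ∀ w : Equiv.Perm ℕ, w ∈ sym (r + 1) → w (r + 1) + d = r + 1 →
        ∃ l, IsExpression (r + 1) w l by
      intro w hw
      have hle : w (r + 1) ≤ r + 1 := by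
        by_contra hlt
        have h1 := hw (w (r + 1)) (by simp only [Set.mem_Icc]; omega)
        have h2 := w.injective h1
        omega
      exact H (r + 1 - w (r + 1)) w hw (by omega)
    intro d
    induction d with
    | zero =>
      intro w hw h
      obtain ⟨l, hl, hlw⟩ := ih w (by
        intro x hx
        by_cases hxr : x = r + 1
        · subst hxr; omega
        · apply hw
          simp only [Set.mem_Icc] at hx ⊢
          omega)
      exact ⟨l, fun i hi => ⟨(hl i hi).1, by have := (hl i hi).2; omega⟩, hlw⟩
    | succ d ihd =>
      intro w hw h
      have hk1 : 1 ≤ w (r + 1) := by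
        by_contra hlt
        have h0 : w (r + 1) = 0 := by omega
        have h1 := hw 0 (by simp)
        have h2 := w.injective (h0.trans h1.symm)
        omega
      have hks : s (w (r + 1)) ∈ sym (r + 1) := s_mem_sym hk1 (by omega)
      obtain ⟨l, hl, hlw⟩ := ihd (s (w (r + 1)) * w) ((sym (r + 1)).mul_mem hks hw) (by
        rw [Equiv.Perm.mul_apply]
        simp only [s, Equiv.swap_apply_left]
        omega)
      refine ⟨l ++ [w (r + 1)], ?_, ?_⟩
      · intro i hi
        rcases List.mem_append.1 hi with hi | hi
        · exact hl i hi
        · simp only [List.mem_singleton] at hi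
          subst hi
          exact ⟨hk1, by omega⟩
      · have : wordPerm (l ++ [w (r + 1)]) = s (w (r + 1)) * wordPerm l := by
          simp [wordPerm]
        rw [this, hlw, ← mul_assoc]
        simp [s]

theorem exists_reduced {r : ℕ} (w : sym r) : ∃ l, IsReduced r w l := by
  classical
  have hex : ∃ n, ∃ l, IsExpression r w l ∧ l.length = n := by
    obtain ⟨l, hl⟩ := exists_expression r w w.2
    exact ⟨_, l, hl, rfl⟩
  obtain ⟨l, hl, hn⟩ := Nat.find_spec hex
  exact ⟨l, hl, fun l' hl' => hn.le.trans (Nat.find_min' hex ⟨l', hl', rfl⟩)⟩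

/-- A choice of a reduced expression of `w`. -/
noncomputable def reducedWord {r : ℕ} (w : sym r) : List ℕ := (exists_reduced w).choose

/-! ### The set `Λ[m, r]`, Young subgroups and the permutations `w_𝐚` -/

/-- `Λ[m, r]`: the sequences `0 = a_0 ≤ a_1 ≤ ⋯ ≤ a_m = r` of integers. -/
@[ext] structure Lam (m r : ℕ) where
  toFun : Fin (m + 1) → ℕ
  zero' : toFun 0 = 0
  last' : toFun (Fin.last m) = r
  mono' : Monotone toFun

instance (m r : ℕ) : CoeFun (Lam m r) (fun _ => Fin (m + 1) → ℕ) := ⟨Lam.toFun⟩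

theorem Lam.le {m r : ℕ} (a : Lam m r) (k : Fin (m + 1)) : a k ≤ r :=
  (a.mono' (Fin.le_last k)).trans_eq a.last'

/-- `𝐚' = [0, r - a_{m-1}, …, r - a_1, r]`. -/
def Lam.dual {m r : ℕ} (a : Lam m r) : Lam m r where
  toFun k := r - a k.rev
  zero' := by simp [a.last']
  last' := by simp [a.zero']
  mono' := fun _ _ h => Nat.sub_le_sub_left (a.mono' (Fin.rev_le_rev.2 h)) r

theorem Lam.dual_dual {m r : ℕ} (a : Lam m r) : a.dual.dual = a := by
  ext k
  have := a.le k
  simp only [Lam.dual, Fin.rev_rev]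
  omega

/-- The `j`-th block `{a_{j-1} + 1, …, a_j}`; here `j : Fin m` counts from zero. -/
def Lam.block {m r : ℕ} (a : Lam m r) (j : Fin m) : Set ℕ := Set.Ioc (a j.castSucc) (a j.succ)

/-- The Young subgroup of the symmetric group on `{1, …, r}`: the permutations preserving each
block of `𝐚`. -/
def young {m r : ℕ} (a : Lam m r) : Subgroup (Equiv.Perm ℕ) where
  carrier := {w | w ∈ sym r ∧ ∀ j x, w x ∈ a.block j ↔ x ∈ a.block j}
  mul_mem' := by
    rintro v w ⟨hv, hv'⟩ ⟨hw, hw'⟩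
    exact ⟨(sym r).mul_mem hv hw, fun j x => by rw [Equiv.Perm.mul_apply, hv', hw']⟩
  one_mem' := ⟨(sym r).one_mem, fun _ _ => Iff.rfl⟩
  inv_mem' := by
    rintro w ⟨hw, hw'⟩
    refine ⟨(sym r).inv_mem hw, fun j x => ?_⟩
    rw [← hw' j (w⁻¹ x), ← Equiv.Perm.mul_apply, mul_inv_cancel, Equiv.Perm.one_apply]

theorem Lam.block_unique {m r : ℕ} (a : Lam m r) {j k : Fin m} {x : ℕ} (hj : x ∈ a.block j)
    (hk : x ∈ a.block k) : j = k := by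
  simp only [Lam.block, Set.mem_Ioc] at hj hk
  rcases lt_trichotomy j k with h | h | h
  · have := a.mono' (Fin.succ_le_castSucc_iff.2 h)
    omega
  · exact h
  · have := a.mono' (Fin.succ_le_castSucc_iff.2 h)
    omega

theorem Lam.exists_block {m r : ℕ} (a : Lam m r) {x : ℕ} (h1 : 1 ≤ x) (h2 : x ≤ r) :
    ∃ j, x ∈ a.block j := by
  have H : ∀ k : Fin (m + 1), x ≤ a k → ∃ j, x ∈ a.block j := by
    intro k
    induction k using Fin.induction with
    | zero =>
      intro h
      have := a.zero'
      omega
    | succ j ih =>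
      intro h
      by_cases hc : x ≤ a j.castSucc
      · exact ih hc
      · exact ⟨j, by simpa [Lam.block] using ⟨not_le.1 hc, h⟩⟩
  exact H (Fin.last m) (h2.trans_eq a.last'.symm)

open Classical in
/-- The function underlying `w_𝐚`: for `x = a_{j-1} + l` in the `j`-th block it takes the value
`r - a_j + l`, and it fixes everything outside the blocks. -/
noncomputable def wFun {m r : ℕ} (a : Lam m r) (x : ℕ) : ℕ :=
  if h : ∃ j, x ∈ a.block j then r - a h.choose.succ + (x - a h.choose.castSucc) else x

theorem wFun_of_mem {m r : ℕ} (a : Lam m r) {j : Fin m} {x : ℕ} (hj : x ∈ a.block j) :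
    wFun a x = r - a j.succ + (x - a j.castSucc) := by
  have h : ∃ j, x ∈ a.block j := ⟨j, hj⟩
  rw [wFun, dif_pos h, a.block_unique h.choose_spec hj]

theorem wFun_dual {m r : ℕ} (a : Lam m r) (x : ℕ) : wFun a.dual (wFun a x) = x := by
  by_cases h : ∃ j, x ∈ a.block j
  · obtain ⟨j, hj⟩ := h
    have hx := hj
    simp only [Lam.block, Set.mem_Ioc] at hx
    have h1 := a.le j.succ
    have h2 := a.le j.castSucc
    have e1 : a.dual j.rev.castSucc = r - a j.succ := by simp [Lam.dual, Fin.rev_castSucc]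
    have e2 : a.dual j.rev.succ = r - a j.castSucc := by simp [Lam.dual, Fin.rev_succ]
    have hm : wFun a x ∈ a.dual.block j.rev := by
      rw [wFun_of_mem a hj]
      simp only [Lam.block, Set.mem_Ioc, e1, e2]
      omega
    rw [wFun_of_mem _ hm, e1, e2, wFun_of_mem a hj]
    omega
  · have e : wFun a x = x := by rw [wFun, dif_neg h]
    rw [e, wFun, dif_neg]
    rintro ⟨j, hj⟩
    have hj' := a.dual.le j.succ
    simp only [Lam.block, Set.mem_Ioc] at hj
    exact h (a.exists_block (by omega) (by omega))

/-- The permutation `w_𝐚` of `{1, …, r}`. -/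
noncomputable def wPerm {m r : ℕ} (a : Lam m r) : sym r :=
  ⟨{ toFun := wFun a
     invFun := wFun a.dual
     left_inv := wFun_dual a
     right_inv := fun x => by
      have := wFun_dual a.dual x
      rwa [Lam.dual_dual] at this }, by
    intro x hx
    change wFun a x = x
    rw [wFun, dif_neg]
    rintro ⟨j, hj⟩
    have := a.le j.succ
    simp only [Lam.block, Set.mem_Ioc, Set.mem_Icc] at hj hx
    omega⟩

/-- The defining property `(a_{j-1} + l) w_𝐚 = r - a_j + l` for `1 ≤ l ≤ a_j - a_{j-1}`. -/
theorem wPerm_apply {m r : ℕ} (a : Lam m r) (j : Fin m) (l : ℕ) (h1 : 1 ≤ l)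
    (h2 : l ≤ a j.succ - a j.castSucc) :
    (wPerm a : Equiv.Perm ℕ) (a j.castSucc + l) = r - a j.succ + l := by
  have hj : a j.castSucc + l ∈ a.block j := by
    simp only [Lam.block, Set.mem_Ioc]
    omega
  change wFun a _ = _
  rw [wFun_of_mem a hj]
  omega

/-! ### The Ariki–Koike algebra -/

/-- The defining relations of the Ariki–Koike algebra, in generators `T_0, …, T_{r-1}`, with
parameters `q` and `u_1, …, u_m` (`u_{k+1}` is `u k` here). -/
inductive Rel {R : Type*} [CommRing R] {m : ℕ} (q : Rˣ) (u : Fin m → R) (r : ℕ) :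
    FreeAlgebra R (Fin r) → FreeAlgebra R (Fin r) → Prop
  | braid_four (i j : Fin r) (hi : i.val = 0) (hj : j.val = 1) :
      Rel q u r
        (FreeAlgebra.ι R i * FreeAlgebra.ι R j * FreeAlgebra.ι R i * FreeAlgebra.ι R j)
        (FreeAlgebra.ι R j * FreeAlgebra.ι R i * FreeAlgebra.ι R j * FreeAlgebra.ι R i)
  | braid_three (i j : Fin r) (hi : 1 ≤ i.val) (hj : j.val = i.val + 1) :
      Rel q u r
        (FreeAlgebra.ι R i * FreeAlgebra.ι R j * FreeAlgebra.ι R i)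
        (FreeAlgebra.ι R j * FreeAlgebra.ι R i * FreeAlgebra.ι R j)
  | comm (i j : Fin r) (h : i.val + 2 ≤ j.val) :
      Rel q u r
        (FreeAlgebra.ι R i * FreeAlgebra.ι R j) (FreeAlgebra.ι R j * FreeAlgebra.ι R i)
  | quadratic (i : Fin r) (hi : i.val ≠ 0) :
      Rel q u r
        ((FreeAlgebra.ι R i - algebraMap R _ (q : R)) * (FreeAlgebra.ι R i + 1)) 0
  | cyclotomic (i : Fin r) (hi : i.val = 0) :
      Rel q u r
        (List.ofFn fun k : Fin m => FreeAlgebra.ι R i - algebraMap R _ (u k)).prod 0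

/-- The Ariki–Koike algebra over `R` with parameters `q` (invertible) and `u_1, …, u_m`. -/
def Alg {R : Type*} [CommRing R] {m : ℕ} (q : Rˣ) (u : Fin m → R) (r : ℕ) : Type _ :=
  RingQuot (Rel q u r)

section

variable {R : Type*} [CommRing R] {m : ℕ} (q : Rˣ) (u : Fin m → R) (r : ℕ)

noncomputable instance : Ring (Alg q u r) := inferInstanceAs (Ring (RingQuot (Rel q u r)))

noncomputable instance : Algebra R (Alg q u r) :=
  inferInstanceAs (Algebra R (RingQuot (Rel q u r)))

/-- The generator `T_i`, for `0 ≤ i ≤ r - 1` (and the irrelevant value `0` for `i ≥ r`). -/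
noncomputable def T (i : ℕ) : Alg q u r :=
  if h : i < r then RingQuot.mkAlgHom R (Rel q u r) (FreeAlgebra.ι R ⟨i, h⟩) else 0

/-- `L_1 = T_0` and `L_{i+1} = q⁻¹ T_i L_i T_i`; used only for `1 ≤ i ≤ r` (the value at `0` is
irrelevant). -/
noncomputable def L : ℕ → Alg q u r
  | 0 => 0
  | 1 => T q u r 0
  | i + 2 => ((q⁻¹ : Rˣ) : R) • (T q u r (i + 1) * L (i + 1) * T q u r (i + 1))

variable {r}

/-- `T_w = T_{i₁} ⋯ T_{i_k}` for a reduced expression `w = s_{i₁} ⋯ s_{i_k}`. -/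
noncomputable def Tw (w : sym r) : Alg q u r := ((reducedWord w).map (T q u r)).prod

variable (r) in
/-- For a subgroup `P` of the symmetric group on `{1, …, r}` (used for subgroups generated by
basic transpositions), the subalgebra generated by the `T_i` with `s_i ∈ P`. For `P = sym r` it is
generated by all `T_i` with `1 ≤ i ≤ r - 1`. -/
noncomputable def hecke (P : Subgroup (Equiv.Perm ℕ)) : Subalgebra R (Alg q u r) :=
  Algebra.adjoin R {t | ∃ i, 1 ≤ i ∧ i < r ∧ s i ∈ P ∧ t = T q u r i}

variable (r) in
/-- `π_c(x) = (L_1 - x) ⋯ (L_c - x)`. -/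
noncomputable def piOne (c : ℕ) (x : R) : Alg q u r :=
  ((List.range c).map fun j => L q u r (j + 1) - algebraMap R _ x).prod

/-- `π_𝐚 = π_{a_1}(u_2) ⋯ π_{a_{m-1}}(u_m)`. Since `u j` is `u_{j+1}`, the product runs over
`π_{a_j}(u_{j+1})` for `0 ≤ j ≤ m - 1`; the additional factor for `j = 0` is `1`, as `a_0 = 0`. -/
noncomputable def piA (a : Lam m r) : Alg q u r :=
  (List.ofFn fun j : Fin m => piOne q u r (a j.castSucc) (u j)).prod

/-- `π̃_𝐚 = π_{a_1}(u_{m-1}) ⋯ π_{a_{m-1}}(u_1)`. Since `u j.rev` is `u_{m-j}`, the product runs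
over `π_{a_j}(u_{m-j})` for `0 ≤ j ≤ m - 1`; the additional factor for `j = 0` is `1`. -/
noncomputable def piTilde (a : Lam m r) : Alg q u r :=
  (List.ofFn fun j : Fin m => piOne q u r (a j.castSucc) (u j.rev)).prod

/-- `v_𝐚 = π_𝐚 T_{w_𝐚} π̃_{𝐚'}`. -/
noncomputable def v (a : Lam m r) : Alg q u r :=
  piA q u a * Tw q u (wPerm a) * piTilde q u a.dual

end

end ArikiKoike

/-! The `L i` commute, so both `π_𝐚` and `π̃_{𝐚'}` are values of polynomials `∏_j ∏_{i ≤ c_j} (L_i -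
u_j)`, with exponents `c_j = a_{j-1}` and `c_j = r - a_j` respectively. Two facts about such
products carry the proof.

Commutation (`commute_T_piPoly`): `T_i` commutes with the product unless some `c_j = i`, because
`L_i` and `L_{i+1}` otherwise enter symmetrically.

Vanishing (`piPoly_vanish`): let the left exponents be at least `x` on a set `S` of indices and the
right ones at least `y` off `S`, where `x, y ≤ n < x + y`. Then left product, any element of
`ℋ(𝔖_n)`, right product multiply to zero. By induction on `n` this reduces to the cyclotomic
relation `∏_j (L_1 - u_j) = 0`.

For (a), all data are truncated to `{1, …, n}`. Elements of `ℋ(𝔖_{n+1})` are combinations of `x T_n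
T_{n-1} ⋯ T_{n+1-e}` with `x ∈ ℋ(𝔖_n)`. If `e` is smaller than the left end of the block containing
`n + 1`, the term vanishes. Otherwise the word splits into the segment by which `T_{w_𝐚}` grows and
letters in the Young subgroup of `𝐚'`, and induction applies (`lft_mul_mul_rgt`). Braid relations
let `v_𝐚` intertwine the two Young subalgebras.

For (b), vanishing makes `v_𝐚` an eigenvector, on either side, of the `L` at the start of each
block, and `L_{i+1} = q⁻¹ T_i L_i T_i` propagates this inside the block. For (c) and (d), `𝐇` is
spanned by products `f(L) h` with `h ∈ ℋ`. The factor `f(L)` commutes with `π_𝐚`, and by (b) it is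
absorbed next to `v_𝐚` on either side. -/

namespace ArikiKoike

/-! ### Braid words -/

/-- The decreasing word `[k + d - 1, …, k + 1, k]`. -/
def desc (k : ℕ) : ℕ → List ℕ
  | 0 => []
  | d + 1 => (k + d) :: desc k d

theorem mem_desc {k d i : ℕ} : i ∈ desc k d ↔ k ≤ i ∧ i < k + d := by
  induction d with
  | zero => simp [desc]
  | succ d ih => simp only [desc, List.mem_cons, ih]; omega

theorem desc_add (k d e : ℕ) : desc k (d + e) = desc (k + d) e ++ desc k d := by
  induction e with
  | zero => simp [desc]
  | succ e ih => rw [← add_assoc, desc, ih, desc, List.cons_append, add_assoc]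

theorem desc_succ' (k d : ℕ) : desc k (d + 1) = desc (k + 1) d ++ [k] := by
  rw [add_comm, desc_add]; rfl

/-- The product of the letters of a word. -/
def wprod {M : Type*} [Monoid M] (t : ℕ → M) (l : List ℕ) : M := (l.map t).prod

section Braid

variable {M : Type*} [Monoid M] {t : ℕ → M}

@[simp] theorem wprod_nil : wprod t [] = 1 := rfl

@[simp] theorem wprod_cons (i : ℕ) (l : List ℕ) : wprod t (i :: l) = t i * wprod t l := by
  simp [wprod]

@[simp] theorem wprod_append (l l' : List ℕ) : wprod t (l ++ l') = wprod t l * wprod t l' := by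
  simp [wprod]

theorem commute_wprod {x : M} {l : List ℕ} (h : ∀ i ∈ l, Commute x (t i)) :
    Commute x (wprod t l) :=
  Commute.list_prod_right _ _ (by simpa using h)

/-- The braid relations of type `A` for a sequence of elements `t 1, t 2, …`. -/
structure Braid (t : ℕ → M) : Prop where
  comm : ∀ i j, 1 ≤ i → i + 2 ≤ j → Commute (t i) (t j)
  braid : ∀ i, 1 ≤ i → t i * t (i + 1) * t i = t (i + 1) * t i * t (i + 1)

theorem Braid.commute_desc_of_lt (ht : Braid t) {i k : ℕ} (d : ℕ) (hi : 1 ≤ i) (h : i + 2 ≤ k) :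
    Commute (t i) (wprod t (desc k d)) :=
  commute_wprod fun j hj => ht.comm i j hi (by have := mem_desc.1 hj; omega)

theorem Braid.commute_desc_of_gt (ht : Braid t) {i k d : ℕ} (hk : 1 ≤ k) (h : k + d + 1 ≤ i) :
    Commute (t i) (wprod t (desc k d)) :=
  commute_wprod fun j hj => by
    have := mem_desc.1 hj
    exact (ht.comm j i (by omega) (by omega)).symm

/-- The letter `i + 1` passes everything below `i`, the braid relation turns `t (i + 1) * t i * t (i
+ 1)` into `t i * t (i + 1) * t i`, and the freed `t i` passes everything above `i + 1`. -/
theorem Braid.desc_mul (ht : Braid t) {i k d : ℕ} (hk : 1 ≤ k) (hi : k ≤ i) (h : i + 2 ≤ k + d) :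
    wprod t (desc k d) * t (i + 1) = t i * wprod t (desc k d) := by
  induction d with
  | zero => omega
  | succ d ih =>
    rcases Nat.lt_or_ge (i + 1) (k + d) with h' | h'
    · rw [desc, wprod_cons, mul_assoc, ih (by omega), ← mul_assoc, ← mul_assoc,
        (ht.comm i (k + d) (by omega) (by omega)).eq]
    · obtain ⟨d, rfl⟩ : ∃ d', d = d' + 1 := ⟨d - 1, by omega⟩
      obtain rfl : i = k + d := by omega
      rw [desc, desc, wprod_cons, wprod_cons, mul_assoc, mul_assoc,
        ← (ht.commute_desc_of_gt hk (by omega : k + d + 1 ≤ k + d + 1)).eq, ← add_assoc,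
        ← mul_assoc, ← mul_assoc, ← ht.braid _ (by omega), mul_assoc, mul_assoc]

theorem Braid.desc_mul_desc (ht : Braid t) {k d e : ℕ} (hk : 1 ≤ k) (h : e < d) :
    wprod t (desc k d) * wprod t (desc (k + 1) e) =
      wprod t (desc k e) * wprod t (desc k d) := by
  induction e with
  | zero => simp [desc]
  | succ e ih =>
    rw [desc, desc, wprod_cons, wprod_cons, ← mul_assoc, show k + 1 + e = k + e + 1 by omega,
      ht.desc_mul hk (by omega) (by omega), mul_assoc, ih (by omega), mul_assoc]

end Braid

/-! ### Canonical words of permutations, and independence of `T_w` from the reduced word -/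

theorem wordPerm_append (l l' : List ℕ) : wordPerm (l ++ l') = wordPerm l' * wordPerm l := by
  simp [wordPerm]

/-- Words act from the right, so their letters multiply in the opposite group. In this form the
braid lemmas apply to permutations as well as to the `T i`. -/
theorem wordPerm_eq (l : List ℕ) :
    wordPerm l = (wprod (fun i => MulOpposite.op (s i)) l).unop := by
  induction l with
  | nil => rfl
  | cons i l ih =>
    rw [← List.singleton_append, wordPerm_append, ih]
    simp [wordPerm]

theorem wprod_op_s (l : List ℕ) :
    wprod (fun i => MulOpposite.op (s i)) l = MulOpposite.op (wordPerm l) := by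
  rw [wordPerm_eq, MulOpposite.op_unop]

theorem s_mul_s (i : ℕ) : s i * s i = 1 := Equiv.swap_mul_self _ _

theorem braid_s : Braid fun i => MulOpposite.op (s i) where
  comm i j _ h := by
    apply MulOpposite.unop_injective
    ext x
    simp only [s, MulOpposite.unop_mul, MulOpposite.unop_op, Equiv.Perm.mul_apply,
      Equiv.swap_apply_def]
    split_ifs <;> omega
  braid i _ := by
    apply MulOpposite.unop_injective
    ext x
    simp only [s, MulOpposite.unop_mul, MulOpposite.unop_op, Equiv.Perm.mul_apply,
      Equiv.swap_apply_def]
    split_ifs <;> omega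

/-- The canonical word `C_n`: one has `C_{n+1} = C_n ++ [n, …, n + 1 - e_n]`. -/
def canWord (e : ℕ → ℕ) : ℕ → List ℕ
  | 0 => []
  | n + 1 => canWord e n ++ desc (n + 1 - e n) (e n)

theorem canWord_congr {e e' : ℕ → ℕ} {n : ℕ} (h : ∀ k < n, e k = e' k) :
    canWord e n = canWord e' n := by
  induction n with
  | zero => rfl
  | succ n ih => rw [canWord, canWord, ih fun k hk => h k (by omega), h n (by omega)]

theorem mem_canWord {e : ℕ → ℕ} (he : ∀ k, e k ≤ k) {n i : ℕ} (h : i ∈ canWord e n) :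
    1 ≤ i ∧ i < n := by
  induction n with
  | zero => simp [canWord] at h
  | succ n ih =>
    have := he n
    rcases List.mem_append.1 h with h | h
    · have := ih h; omega
    · have := mem_desc.1 h; omega

/-- Right multiplication of a canonical word by a letter yields a canonical word, which is longer
by one and equal by the braid relations, or shorter by one. -/
theorem canWord_append {M : Type*} [Monoid M] {t : ℕ → M} (ht : Braid t) (n : ℕ) :
    ∀ (e : ℕ → ℕ), (∀ k, e k ≤ k) → ∀ i, 1 ≤ i → i < n →
    ∃ e' : ℕ → ℕ, (∀ k, e' k ≤ k) ∧
      wordPerm (canWord e n ++ [i]) = wordPerm (canWord e' n) ∧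
      (((canWord e' n).length = (canWord e n).length + 1 ∧
          wprod t (canWord e n) * t i = wprod t (canWord e' n)) ∨
        (canWord e' n).length + 1 = (canWord e n).length) := by
  induction n with
  | zero => intro _ _ _ _ h; omega
  | succ n ih =>
    intro e he i hi hin
    have hen := he n
    -- the letter `i` moves past the last segment and becomes `i'`
    have key : ∀ i', 1 ≤ i' → i' < n →
        wprod t (desc (n + 1 - e n) (e n)) * t i =
          t i' * wprod t (desc (n + 1 - e n) (e n)) →
        wprod (fun i => MulOpposite.op (s i)) (desc (n + 1 - e n) (e n)) * MulOpposite.op (s i) =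
          MulOpposite.op (s i') *
            wprod (fun i => MulOpposite.op (s i)) (desc (n + 1 - e n) (e n)) →
        ∃ e' : ℕ → ℕ, (∀ k, e' k ≤ k) ∧
          wordPerm (canWord e (n + 1) ++ [i]) = wordPerm (canWord e' (n + 1)) ∧
          (((canWord e' (n + 1)).length = (canWord e (n + 1)).length + 1 ∧
              wprod t (canWord e (n + 1)) * t i = wprod t (canWord e' (n + 1))) ∨
            (canWord e' (n + 1)).length + 1 = (canWord e (n + 1)).length) := by
      intro i' hi1 hi2 hc hc0
      obtain ⟨e', he', h1, h2⟩ := ih e he i' hi1 hi2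
      have hup : canWord (Function.update e' n (e n)) (n + 1) =
          canWord e' n ++ desc (n + 1 - e n) (e n) := by
        rw [canWord, Function.update_self]
        congr 1
        exact canWord_congr fun k hk => Function.update_of_ne (by omega) _ _
      refine ⟨Function.update e' n (e n), ?_, ?_, ?_⟩
      · intro k
        by_cases hk : k = n
        · subst hk; simpa using hen
        · simpa [hk] using he' k
      · rw [hup, canWord]
        apply MulOpposite.op_injective
        have h4 := congrArg MulOpposite.op h1
        simp only [← wprod_op_s, wprod_append, wprod_cons, wprod_nil, mul_one] at h4 ⊢
        rw [mul_assoc, hc0, ← mul_assoc, h4]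
      · rw [hup, canWord]
        simp only [List.length_append, wprod_append]
        rcases h2 with ⟨h2, h3⟩ | h2
        · refine Or.inl ⟨by omega, ?_⟩
          rw [mul_assoc, hc, ← mul_assoc, h3]
        · right; omega
    -- the last segment is lengthened or shortened
    have hupd : ∀ c ≤ n, (∀ k, Function.update e n c k ≤ k) ∧
        canWord (Function.update e n c) (n + 1) = canWord e n ++ desc (n + 1 - c) c := by
      intro c hc
      refine ⟨fun k => ?_, ?_⟩
      · by_cases hk : k = n
        · subst hk; simpa using hc
        · simpa [hk] using he k
      · rw [canWord, Function.update_self]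
        congr 1
        exact canWord_congr fun k hk => Function.update_of_ne (by omega) _ _
    rcases lt_trichotomy i (n + 1 - e n) with h | h | h
    · rcases Nat.lt_or_ge (i + 1) (n + 1 - e n) with h' | h'
      · exact key i hi (by omega)
          (ht.commute_desc_of_lt _ hi (by omega)).eq.symm
          (braid_s.commute_desc_of_lt _ hi (by omega)).eq.symm
      · obtain ⟨h1, h2⟩ := hupd (e n + 1) (by omega)
        have h3 : canWord (Function.update e n (e n + 1)) (n + 1) = canWord e (n + 1) ++ [i] := by
          rw [h2, desc_succ', canWord, show n + 1 - (e n + 1) + 1 = n + 1 - e n by omega,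
            show n + 1 - (e n + 1) = i by omega, List.append_assoc]
        refine ⟨_, h1, by rw [h3], Or.inl ⟨by rw [h3]; simp, by rw [h3]; simp⟩⟩
    · obtain ⟨c, hc⟩ : ∃ c, e n = c + 1 := ⟨e n - 1, by omega⟩
      obtain ⟨h1, h2⟩ := hupd c (by omega)
      have h3 : canWord e (n + 1) = canWord (Function.update e n c) (n + 1) ++ [i] := by
        rw [h2, canWord, hc, desc_succ', show n + 1 - (c + 1) + 1 = n + 1 - c by omega,
            show n + 1 - (c + 1) = i by omega, List.append_assoc]
      refine ⟨_, h1, ?_, Or.inr (by rw [h3]; simp)⟩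
      rw [h3, wordPerm_append, wordPerm_append, ← mul_assoc]
      simp [wordPerm, s_mul_s]
    · obtain ⟨i, rfl⟩ : ∃ c, i = c + 1 := ⟨i - 1, by omega⟩
      exact key i (by omega) (by omega)
          (ht.desc_mul (by omega) (by omega) (by omega))
          (braid_s.desc_mul (by omega) (by omega) (by omega))

/-- The word is read letter by letter while a canonical word is maintained. For a reduced word the
canonical word never shortens, so only braid relations are used and the product is preserved. -/
theorem exists_canWord {M : Type*} [Monoid M] {t : ℕ → M} (ht : Braid t) {n : ℕ} (l : List ℕ) :
    (∀ i ∈ l, 1 ≤ i ∧ i < n) →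
    ∃ e : ℕ → ℕ, (∀ k, e k ≤ k) ∧ wordPerm l = wordPerm (canWord e n) ∧
      (canWord e n).length ≤ l.length ∧
      (IsReduced n (wordPerm l) l → wprod t l = wprod t (canWord e n)) := by
  induction l using List.reverseRecOn with
  | nil =>
    intro _
    have h : canWord (fun _ => 0) n = [] := by
      clear * -
      induction n with
      | zero => rfl
      | succ n ih => rw [canWord, ih]; rfl
    exact ⟨fun _ => 0, fun _ => Nat.zero_le _, by rw [h], by rw [h], fun _ => by rw [h]⟩
  | append_singleton l i ih =>
    intro hl
    obtain ⟨e, he, h1, h2, h3⟩ := ih fun j hj => hl j (by simp [hj])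
    obtain ⟨hi1, hi2⟩ := hl i (by simp)
    obtain ⟨e', he', h4, h5⟩ := canWord_append ht n e he i hi1 hi2
    have h6 : wordPerm (l ++ [i]) = wordPerm (canWord e' n) := by
      rw [← h4, wordPerm_append, wordPerm_append, h1]
    refine ⟨e', he', h6, by rw [List.length_append, List.length_singleton]; omega, ?_⟩
    intro hred
    have hlred : IsReduced n (wordPerm l) l := by
      refine ⟨⟨fun j hj => hl j (by simp [hj]), rfl⟩, fun l' hl' => ?_⟩
      have := hred.2 (l' ++ [i]) ⟨by
        intro j hj
        rcases List.mem_append.1 hj with hj | hj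
        · exact hl'.1 j hj
        · obtain rfl := List.mem_singleton.1 hj
          exact ⟨hi1, hi2⟩, by rw [wordPerm_append, wordPerm_append, hl'.2]⟩
      simpa using this
    -- Minimality excludes the shortening alternative: it would express the same permutation by a
    -- word shorter than `l ++ [i]`.
    have h7 := hred.2 (canWord e' n) ⟨fun j hj => mem_canWord he' hj, h6.symm⟩
    rw [List.length_append, List.length_singleton] at h7
    rcases h5 with ⟨-, h5⟩ | h5
    · rw [wprod_append, h3 hlred, wprod_cons, wprod_nil, mul_one, h5]
    · omega

theorem wordPerm_desc (k d x : ℕ) :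
    wordPerm (desc k d) x =
      if x = k + d then k else if k ≤ x ∧ x < k + d then x + 1 else x := by
  induction d generalizing x with
  | zero =>
    simp only [desc, wordPerm, List.map_nil, List.reverse_nil, List.prod_nil,
      Equiv.Perm.one_apply]
    split_ifs <;> omega
  | succ d ih =>
    rw [desc, ← List.singleton_append, wordPerm_append, Equiv.Perm.mul_apply]
    have : wordPerm [k + d] x = s (k + d) x := by simp [wordPerm]
    rw [this, ih, s, Equiv.swap_apply_def]
    split_ifs <;> omega

theorem wordPerm_mem_sym {n : ℕ} {l : List ℕ} (h : ∀ i ∈ l, 1 ≤ i ∧ i < n) :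
    wordPerm l ∈ sym n := by
  unfold wordPerm
  apply Subgroup.list_prod_mem
  simp only [List.mem_reverse, List.mem_map]
  rintro _ ⟨i, hi, rfl⟩
  exact s_mem_sym (h i hi).1 (h i hi).2

/-- The last segment can be read off from the permutation, whose value at `n + 1` is `n + 1 - e n`;
cancelling that segment gives the induction. -/
theorem canWord_injective {e e' : ℕ → ℕ} (he : ∀ k, e k ≤ k) (he' : ∀ k, e' k ≤ k) {n : ℕ}
    (h : wordPerm (canWord e n) = wordPerm (canWord e' n)) : canWord e n = canWord e' n := by
  induction n with
  | zero => rfl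
  | succ n ih =>
    have hfix : ∀ {e : ℕ → ℕ}, (∀ k, e k ≤ k) →
        wordPerm (canWord e (n + 1)) (n + 1) = n + 1 - e n := by
      intro e he
      have := he n
      rw [canWord, wordPerm_append, Equiv.Perm.mul_apply,
        wordPerm_mem_sym (fun i hi => mem_canWord he hi) (n + 1) (by simp), wordPerm_desc,
        if_pos (by omega)]
    have h1 : e n = e' n := by
      have h1 := hfix he
      have h2 := hfix he'
      rw [h] at h1
      have := he n
      have := he' n
      omega
    rw [canWord, canWord, wordPerm_append, wordPerm_append, h1] at h
    rw [canWord, canWord, ih (mul_left_cancel h), h1]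

/-- A reduced word has the same product as the canonical word of its permutation. -/
theorem wprod_eq_of_isReduced {M : Type*} [Monoid M] {t : ℕ → M} (ht : Braid t) {n : ℕ}
    {w : Equiv.Perm ℕ} {l : List ℕ} (hl : IsReduced n w l) {e : ℕ → ℕ} (he : ∀ k, e k ≤ k)
    (hw : wordPerm (canWord e n) = w) : wprod t l = wprod t (canWord e n) := by
  obtain ⟨e', he', h1, -, h2⟩ := exists_canWord ht l hl.1.1
  obtain rfl := hl.1.2
  rw [h2 hl, canWord_injective he' he (h1.symm.trans hw.symm)]

end ArikiKoike
namespace ArikiKoike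

/-! ### Relations in the Ariki–Koike algebra -/

section Relations

variable {R : Type*} [CommRing R] {m : ℕ} (q : Rˣ) (u : Fin m → R) (r : ℕ)

/-- Thanks to this default value the commutation and braid relations hold without an upper bound on
the indices; only the quadratic relation needs `i < r`. -/
theorem T_of_le {i : ℕ} (h : r ≤ i) : T q u r i = 0 := dif_neg (by omega)

/-- The quotient map from the free algebra. -/
noncomputable def mk : FreeAlgebra R (Fin r) →ₐ[R] Alg q u r := RingQuot.mkAlgHom R (Rel q u r)

theorem mk_surjective : Function.Surjective (mk q u r) := RingQuot.mkAlgHom_surjective _ _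

variable {q u r} in
theorem mk_rel {x y : FreeAlgebra R (Fin r)} (h : Rel q u r x y) : mk q u r x = mk q u r y :=
  RingQuot.mkAlgHom_rel R h

theorem T_of_lt {i : ℕ} (h : i < r) :
    T q u r i = mk q u r (FreeAlgebra.ι R ⟨i, h⟩) := dif_pos h

theorem T_comm {i j : ℕ} (h : i + 2 ≤ j) : Commute (T q u r i) (T q u r j) := by
  rcases Nat.lt_or_ge j r with hj | hj
  · rw [T_of_lt q u r hj, T_of_lt q u r (by omega : i < r)]
    have := mk_rel (Rel.comm (q := q) (u := u) ⟨i, by omega⟩ ⟨j, hj⟩ h)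
    rw [map_mul, map_mul] at this
    exact this
  · rw [T_of_le q u r hj]; exact Commute.zero_right _

theorem T_braid {i : ℕ} (h : 1 ≤ i) :
    T q u r i * T q u r (i + 1) * T q u r i = T q u r (i + 1) * T q u r i * T q u r (i + 1) := by
  rcases Nat.lt_or_ge (i + 1) r with hj | hj
  · rw [T_of_lt q u r hj, T_of_lt q u r (by omega : i < r)]
    have := mk_rel
      (Rel.braid_three (q := q) (u := u) ⟨i, by omega⟩ ⟨i + 1, hj⟩ h rfl)
    simpa only [map_mul] using this
  · rw [T_of_le q u r hj]; simp

theorem T_braid_four :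
    T q u r 0 * T q u r 1 * T q u r 0 * T q u r 1 =
      T q u r 1 * T q u r 0 * T q u r 1 * T q u r 0 := by
  rcases Nat.lt_or_ge 1 r with hj | hj
  · rw [T_of_lt q u r hj, T_of_lt q u r (by omega : 0 < r)]
    have := mk_rel
      (Rel.braid_four (q := q) (u := u) ⟨0, by omega⟩ ⟨1, hj⟩ rfl rfl)
    simpa only [map_mul] using this
  · rw [T_of_le q u r hj]; simp

theorem T_braidRel : Braid (T q u r) where
  comm _ _ _ h := T_comm q u r h
  braid _ h := T_braid q u r h

theorem T_sq {i : ℕ} (h1 : 1 ≤ i) (h2 : i < r) :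
    T q u r i * T q u r i = ((q : R) - 1) • T q u r i + (q : R) • 1 := by
  have := mk_rel
      (Rel.quadratic (q := q) (u := u) ⟨i, h2⟩ (by simpa using Nat.one_le_iff_ne_zero.1 h1))
  rw [map_mul, map_sub, map_add, AlgHom.commutes, map_one, map_zero, ← T_of_lt,
    Algebra.algebraMap_eq_smul_one] at this
  have h3 : T q u r i * T q u r i - (((q : R) - 1) • T q u r i + (q : R) • 1) = 0 := by
    rw [← this]
    simp only [sub_mul, mul_add, mul_one, smul_mul_assoc, one_mul, sub_smul, one_smul]
    abel
  exact sub_eq_zero.1 h3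

theorem cyclotomic (h : 0 < r) :
    (List.ofFn fun k : Fin m => T q u r 0 - algebraMap R _ (u k)).prod = 0 := by
  have := mk_rel (Rel.cyclotomic (q := q) (u := u) ⟨0, h⟩ rfl)
  rw [map_list_prod, map_zero, List.map_ofFn] at this
  rw [← this, T_of_lt q u r h]
  congr 2
  funext k
  simp only [Function.comp, map_sub, AlgHom.commutes]

theorem L_succ {i : ℕ} (h : 1 ≤ i) :
    L q u r (i + 1) = ((q⁻¹ : Rˣ) : R) • (T q u r i * L q u r i * T q u r i) := by
  obtain ⟨i, rfl⟩ : ∃ c, i = c + 1 := ⟨i - 1, by omega⟩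
  rfl

theorem T_mul_L_mul_T {i : ℕ} (h : 1 ≤ i) :
    T q u r i * L q u r i * T q u r i = (q : R) • L q u r (i + 1) := by
  rw [L_succ q u r h, smul_smul, Units.mul_inv, one_smul]

theorem commute_T_L_of_lt {i j : ℕ} (h : j < i) : Commute (T q u r i) (L q u r j) := by
  induction j with
  | zero => exact Commute.zero_right _
  | succ j ih =>
    rcases Nat.eq_zero_or_pos j with rfl | hj
    · exact (T_comm q u r h).symm
    · rw [L_succ q u r hj]
      have h1 := (T_comm q u r (i := j) (j := i) h).symm
      exact ((h1.mul_right (ih (by omega))).mul_right h1).smul_right _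

/-- The essential case is `j = i + 2`, where `L_j` is a multiple of `T_{i+1} T_i L_i T_i T_{i+1}`:
the braid relation turns `T_i` into `T_{i+1}`, which passes `L_i`, and a second braid relation turns
it back. -/
theorem commute_T_L_of_gt {i j : ℕ} (hi : 1 ≤ i) (h : i + 2 ≤ j) :
    Commute (T q u r i) (L q u r j) := by
  induction j with
  | zero => omega
  | succ j ih =>
    rw [L_succ q u r (by omega)]
    refine Commute.smul_right ?_ _
    rcases Nat.lt_or_ge (i + 1) j with hj | hj
    · have h1 := T_comm q u r (i := i) (j := j) hj
      exact (h1.mul_right (ih hj)).mul_right h1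
    · obtain rfl : j = i + 1 := by omega
      rw [L_succ q u r hi, mul_smul_comm, smul_mul_assoc]
      refine Commute.smul_right ?_ _
      have h1 := T_braid q u r hi
      have h2 := (commute_T_L_of_lt q u r (Nat.lt_succ_self i)).eq
      set A := T q u r i
      set B := T q u r (i + 1)
      set C := L q u r i
      calc A * (B * (A * C * A) * B) = A * B * A * C * A * B := by simp only [mul_assoc]
        _ = B * A * (B * C) * A * B := by rw [h1]; simp only [mul_assoc]
        _ = B * A * C * (B * A * B) := by rw [h2]; simp only [mul_assoc]
        _ = B * (A * C * A) * B * A := by rw [← h1]; simp only [mul_assoc]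

theorem commute_T_L {i j : ℕ} (hi : 1 ≤ i) (h1 : j ≠ i) (h2 : j ≠ i + 1) :
    Commute (T q u r i) (L q u r j) := by
  rcases Nat.lt_or_ge j i with h | h
  · exact commute_T_L_of_lt q u r h
  · exact commute_T_L_of_gt q u r hi (by omega)

/-- For `L_2` this is the braid relation of length four; later `L_{j+1}` are built from `L_j` and
`T_j` with `j ≥ 2`, which commute with `L_1 = T_0`. -/
theorem commute_L_one {j : ℕ} (h : 1 ≤ j) : Commute (L q u r 1) (L q u r j) := by
  induction j, h using Nat.le_induction with
  | base => exact Commute.refl _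
  | succ j hj ih =>
    rw [L_succ q u r hj]
    refine Commute.smul_right ?_ _
    rcases Nat.eq_or_lt_of_le hj with rfl | hj
    · have := T_braid_four q u r
      change T q u r 0 * (T q u r 1 * T q u r 0 * T q u r 1) =
        T q u r 1 * T q u r 0 * T q u r 1 * T q u r 0
      rw [← this]
      simp only [mul_assoc]
    · have h1 : Commute (L q u r 1) (T q u r j) := (commute_T_L_of_lt q u r hj).symm
      exact (h1.mul_right ih).mul_right h1

theorem commute_L_of_le {i j : ℕ} (h : i ≤ j) : Commute (L q u r i) (L q u r j) := by
  induction i with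
  | zero => exact Commute.zero_left _
  | succ i ih =>
    rcases Nat.eq_or_lt_of_le h with rfl | h
    · exact Commute.refl _
    rcases Nat.eq_zero_or_pos i with rfl | hi
    · exact commute_L_one q u r (by omega)
    · rw [L_succ q u r hi]
      have h1 := commute_T_L_of_gt q u r hi h
      exact ((h1.mul_left (ih (by omega))).mul_left h1).smul_left _

theorem commute_L (i j : ℕ) : Commute (L q u r i) (L q u r j) := by
  rcases le_total i j with h | h
  · exact commute_L_of_le q u r h
  · exact (commute_L_of_le q u r h).symm

theorem T_mul_L_succ {i : ℕ} (h1 : 1 ≤ i) (h2 : i < r) :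
    T q u r i * L q u r (i + 1) =
      L q u r i * T q u r i + ((q : R) - 1) • L q u r (i + 1) := by
  conv_lhs => rw [L_succ q u r h1]
  rw [mul_smul_comm, ← mul_assoc, ← mul_assoc, T_sq q u r h1 h2]
  simp only [add_mul, smul_mul_assoc, one_mul, smul_add, smul_smul]
  rw [T_mul_L_mul_T q u r h1, smul_smul, Units.inv_mul, one_smul, add_comm]
  congr 2
  calc ((q⁻¹ : Rˣ) : R) * (q - 1) * q = (((q⁻¹ : Rˣ) : R) * q) * (q - 1) := by ring
    _ = q - 1 := by rw [Units.inv_mul, one_mul]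

theorem L_succ_mul_T {i : ℕ} (h1 : 1 ≤ i) (h2 : i < r) :
    L q u r (i + 1) * T q u r i =
      T q u r i * L q u r i + ((q : R) - 1) • L q u r (i + 1) := by
  conv_lhs => rw [L_succ q u r h1]
  rw [smul_mul_assoc, mul_assoc _ (T q u r i) (T q u r i), T_sq q u r h1 h2]
  simp only [mul_add, mul_smul_comm, mul_one, smul_add, smul_smul]
  rw [T_mul_L_mul_T q u r h1, smul_smul, Units.inv_mul, one_smul, add_comm]
  congr 2
  calc ((q⁻¹ : Rˣ) : R) * (q - 1) * q = (((q⁻¹ : Rˣ) : R) * q) * (q - 1) := by ring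
    _ = q - 1 := by rw [Units.inv_mul, one_mul]

theorem T_mul_L {i : ℕ} (h1 : 1 ≤ i) (h2 : i < r) :
    T q u r i * L q u r i =
      L q u r (i + 1) * T q u r i - ((q : R) - 1) • L q u r (i + 1) := by
  rw [L_succ_mul_T q u r h1 h2, add_sub_cancel_right]

/-- The symmetric polynomials in `L_i, L_{i+1}` commute with `T_i`. -/
theorem commute_T_pair (i : ℕ) (hi : 1 ≤ i) (x : R) :
    Commute (T q u r i) ((L q u r i - algebraMap R _ x) * (L q u r (i + 1) - algebraMap R _ x)) := by
  rcases Nat.lt_or_ge i r with h | h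
  · have e1 := T_mul_L_succ q u r hi h
    have e2 := L_succ_mul_T q u r hi h
    have e3 := T_mul_L q u r hi h
    have e4 := (commute_L q u r i (i + 1)).eq
    have hprod : Commute (T q u r i) (L q u r i * L q u r (i + 1)) := by
      change _ = _
      rw [← mul_assoc, e3, sub_mul, mul_assoc, e1, mul_add, e4, smul_mul_assoc, mul_smul_comm,
        add_sub_cancel_right, mul_assoc]
    have hsum : Commute (T q u r i) (L q u r i + L q u r (i + 1)) := by
      change _ = _
      rw [mul_add, add_mul, e1, e2]
      abel
    have : (L q u r i - algebraMap R _ x) * (L q u r (i + 1) - algebraMap R _ x) =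
        L q u r i * L q u r (i + 1) - x • (L q u r i + L q u r (i + 1)) + algebraMap R _ (x * x) := by
      simp only [sub_mul, mul_sub, Algebra.algebraMap_eq_smul_one, smul_mul_assoc, mul_smul_comm,
        mul_one, one_mul, smul_add, smul_sub, mul_smul]
      abel
    rw [this]
    exact (hprod.sub_right (hsum.smul_right _)).add_right (Algebra.commute_algebraMap_right _ _)
  · rw [T_of_le q u r h]; exact Commute.zero_left _

end Relations

end ArikiKoike
namespace ArikiKoike

/-! ### Generator-wise arguments in generated subalgebras -/

section Adjoin

variable {R A : Type*} [CommRing R] [Ring A] [Algebra R A]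

/-- Meant for `N` a span of normal forms containing `1`: stability under the generators then places
the whole subalgebra inside `N`. -/
theorem mul_mem_of_mem_adjoin {S : Set A} {N : Submodule R A} (h : ∀ x ∈ N, ∀ t ∈ S, x * t ∈ N)
    {x y : A} (hx : x ∈ N) (hy : y ∈ Algebra.adjoin R S) : x * y ∈ N := by
  induction hy using Algebra.adjoin_induction generalizing x with
  | mem t ht => exact h x hx t ht
  | algebraMap c => rw [← Algebra.commutes, ← Algebra.smul_def]; exact N.smul_mem c hx
  | add y z _ _ h1 h2 => rw [mul_add]; exact N.add_mem (h1 hx) (h2 hx)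
  | mul y z _ _ h1 h2 => rw [← mul_assoc]; exact h2 (h1 hx)

theorem mul_mem_of_mem_adjoin_left {S : Set A} {N : Submodule R A}
    (h : ∀ x ∈ N, ∀ t ∈ S, t * x ∈ N) {x y : A} (hx : x ∈ N) (hy : y ∈ Algebra.adjoin R S) :
    y * x ∈ N := by
  induction hy using Algebra.adjoin_induction generalizing x with
  | mem t ht => exact h x hx t ht
  | algebraMap c => rw [← Algebra.smul_def]; exact N.smul_mem c hx
  | add y z _ _ h1 h2 => rw [add_mul]; exact N.add_mem (h1 hx) (h2 hx)
  | mul y z _ _ h1 h2 => rw [mul_assoc]; exact h1 (h2 hx)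

/-- If `v` moves the generators in `S` from its right to elements of the subalgebra `B` on its
left, then it does so with the subalgebra generated by `S`. -/
theorem exists_mul_eq_of_mem_adjoin {S : Set A} {B : Subalgebra R A} {v : A}
    (h : ∀ t ∈ S, ∃ t' ∈ B, v * t = t' * v) {y : A} (hy : y ∈ Algebra.adjoin R S) :
    ∃ y' ∈ B, v * y = y' * v := by
  induction hy using Algebra.adjoin_induction with
  | mem t ht => exact h t ht
  | algebraMap c => exact ⟨_, B.algebraMap_mem c, (Algebra.commutes _ _).symm⟩
  | add y z _ _ h1 h2 =>
    obtain ⟨y', hy', h1⟩ := h1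
    obtain ⟨z', hz', h2⟩ := h2
    exact ⟨_, B.add_mem hy' hz', by rw [mul_add, add_mul, h1, h2]⟩
  | mul y z _ _ h1 h2 =>
    obtain ⟨y', hy', h1⟩ := h1
    obtain ⟨z', hz', h2⟩ := h2
    exact ⟨_, B.mul_mem hy' hz', by rw [← mul_assoc, h1, mul_assoc, h2, mul_assoc]⟩

theorem exists_mul_eq_of_mem_adjoin' {S : Set A} {B : Subalgebra R A} {v : A}
    (h : ∀ t ∈ S, ∃ t' ∈ B, t * v = v * t') {y : A} (hy : y ∈ Algebra.adjoin R S) :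
    ∃ y' ∈ B, y * v = v * y' := by
  induction hy using Algebra.adjoin_induction with
  | mem t ht => exact h t ht
  | algebraMap c => exact ⟨_, B.algebraMap_mem c, Algebra.commutes _ _⟩
  | add y z _ _ h1 h2 =>
    obtain ⟨y', hy', h1⟩ := h1
    obtain ⟨z', hz', h2⟩ := h2
    exact ⟨_, B.add_mem hy' hz', by rw [mul_add, add_mul, h1, h2]⟩
  | mul y z _ _ h1 h2 =>
    obtain ⟨y', hy', h1⟩ := h1
    obtain ⟨z', hz', h2⟩ := h2
    exact ⟨_, B.mul_mem hy' hz', by rw [mul_assoc, h2, ← mul_assoc, h1, mul_assoc]⟩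

end Adjoin

/-! ### Polynomials in the `L_i`, and the vanishing lemma -/

section Poly

open MvPolynomial

variable {R : Type*} [CommRing R] {m : ℕ} (q : Rˣ) (u : Fin m → R) (r : ℕ)

/-- Evaluation of polynomials at the commuting elements `L_i`. -/
noncomputable def evalL : MvPolynomial ℕ R →ₐ[R] Alg q u r :=
  letI : CommRing (Algebra.adjoin R (Set.range (L q u r))) :=
    { (inferInstance : Ring (Algebra.adjoin R (Set.range (L q u r)))) with
      mul_comm := (Algebra.isMulCommutative_adjoin R (by
        rintro _ ⟨i, rfl⟩ _ ⟨j, rfl⟩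
        exact commute_L q u r i j)).is_comm.comm }
  (Algebra.adjoin R (Set.range (L q u r))).val.comp
    (aeval fun i => ⟨L q u r i, Algebra.subset_adjoin ⟨i, rfl⟩⟩)

@[simp] theorem evalL_X (i : ℕ) : evalL q u r (X i) = L q u r i := by
  simp [evalL]

@[simp] theorem evalL_C (x : R) : evalL q u r (C x) = algebraMap R _ x :=
  (evalL q u r).commutes x

theorem commute_evalL (f g : MvPolynomial ℕ R) : Commute (evalL q u r f) (evalL q u r g) := by
  change _ * _ = _ * _
  rw [← map_mul, mul_comm, map_mul]

/-- `∏_j ∏_{i ≤ c_j} (L_i - u_j)` as a polynomial. -/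
noncomputable def piPoly (c : Fin m → ℕ) : MvPolynomial ℕ R :=
  ∏ j, ∏ i ∈ Finset.range (c j), (X (i + 1) - C (u j))

theorem piPoly_dvd {c d : Fin m → ℕ} (h : c ≤ d) : piPoly u c ∣ piPoly u d :=
  Finset.prod_dvd_prod_of_dvd _ _ fun j _ =>
    Finset.prod_dvd_prod_of_subset _ _ _ (Finset.range_subset_range.2 (h j))

/-- For `c ≠ i` the factors at `i` and `i + 1` occur together or not at all. Strong induction is
used because this pair has to be split off in one step. -/
theorem commute_T_factor {i c : ℕ} (hi : 1 ≤ i) (h : c ≠ i) (x : R) :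
    Commute (T q u r i) (evalL q u r (∏ i ∈ Finset.range c, (X (i + 1) - C x))) := by
  induction c using Nat.strong_induction_on with
  | _ c ih =>
    rcases c with _ | c
    · simp
    · by_cases hc : c = i
      · subst hc
        obtain ⟨c, rfl⟩ : ∃ c', c = c' + 1 := ⟨c - 1, by omega⟩
        rw [Finset.prod_range_succ, Finset.prod_range_succ, mul_assoc, map_mul]
        refine (ih c (by omega) (by omega)).mul_right ?_
        simpa using commute_T_pair q u r (c + 1) hi x
      · rw [Finset.prod_range_succ, map_mul]
        refine (ih c (by omega) hc).mul_right ?_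
        simpa using (commute_T_L q u r hi h (by omega)).sub_right
          (Algebra.commute_algebraMap_right x _)

theorem commute_T_piPoly {i : ℕ} {c : Fin m → ℕ} (hi : 1 ≤ i) (h : ∀ j, c j ≠ i) :
    Commute (T q u r i) (evalL q u r (piPoly u c)) := by
  refine Finset.prod_induction _ (fun f => Commute (T q u r i) (evalL q u r f)) ?_ ?_ ?_
  · intro f g hf hg
    rw [map_mul]
    exact hf.mul_right hg
  · rw [map_one]; exact Commute.one_right _
  · exact fun j _ => commute_T_factor q u r hi (h j) _

/-- The subalgebra generated by the `T_i` with `i ∈ I`. -/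
noncomputable def parab (I : Set ℕ) : Subalgebra R (Alg q u r) :=
  Algebra.adjoin R (T q u r '' I)

variable {q u r}

theorem T_mem_parab {I : Set ℕ} {i : ℕ} (h : i ∈ I) : T q u r i ∈ parab q u r I :=
  Algebra.subset_adjoin ⟨i, h, rfl⟩

theorem parab_mono {I J : Set ℕ} (h : I ⊆ J) : parab q u r I ≤ parab q u r J :=
  Algebra.adjoin_mono (Set.image_mono h)

theorem commute_of_mem_parab {I : Set ℕ} {x y : Alg q u r} (h : ∀ i ∈ I, Commute (T q u r i) x)
    (hy : y ∈ parab q u r I) : Commute y x := by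
  refine (Algebra.commute_of_mem_adjoin_of_forall_mem_commute hy ?_).symm
  rintro _ ⟨i, hi, rfl⟩
  exact (h i hi).symm

theorem wprod_mem_parab {I : Set ℕ} {l : List ℕ} (h : ∀ i ∈ l, i ∈ I) :
    wprod (T q u r) l ∈ parab q u r I := by
  apply Subalgebra.list_prod_mem
  simp only [List.mem_map]
  rintro _ ⟨i, hi, rfl⟩
  exact T_mem_parab (h i hi)

variable (q u r) in
/-- The Hecke algebra of the symmetric group on `{1, …, n}`. -/
noncomputable abbrev heckeA (n : ℕ) : Subalgebra R (Alg q u r) := parab q u r {i | 1 ≤ i ∧ i < n}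

/-- `ℋ(𝔖_{n+1})` is spanned by the products of `ℋ(𝔖_n)` with `T_n T_{n-1} ⋯ T_{n+1-e}`. -/
theorem mem_span_of_mem_heckeA_succ {n : ℕ} (hn : n + 1 ≤ r) {h : Alg q u r}
    (hh : h ∈ heckeA q u r (n + 1)) :
    h ∈ Submodule.span R {y | ∃ x ∈ heckeA q u r n, ∃ e ≤ n,
      y = x * wprod (T q u r) (desc (n + 1 - e) e)} := by
  set N := Submodule.span R {y | ∃ x ∈ heckeA q u r n, ∃ e ≤ n,
      y = x * wprod (T q u r) (desc (n + 1 - e) e)} with hN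
  have hb := T_braidRel q u r
  have hmem : ∀ x ∈ heckeA q u r n, ∀ e ≤ n, x * wprod (T q u r) (desc (n + 1 - e) e) ∈ N :=
    fun x hx e he => Submodule.subset_span ⟨x, hx, e, he, rfl⟩
  have h1 : (1 : Alg q u r) ∈ N := by
    simpa [desc] using hmem 1 (one_mem _) 0 (Nat.zero_le _)
  rw [← one_mul h]
  refine mul_mem_of_mem_adjoin ?_ h1 hh
  rintro x hx _ ⟨i, ⟨hi1, hi2⟩, rfl⟩
  induction hx using Submodule.span_induction with
  | zero => rw [zero_mul]; exact N.zero_mem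
  | add x y _ _ hx hy => rw [add_mul]; exact N.add_mem hx hy
  | smul c x _ hx => rw [smul_mul_assoc]; exact N.smul_mem c hx
  | mem x hx =>
    obtain ⟨x, hx, e, he, rfl⟩ := hx
    rw [mul_assoc]
    -- A letter well below the segment passes it; the letter just below lengthens it; its own last
    -- letter is handled by the quadratic relation; a higher letter emerges on the left lowered by
    -- one, hence in `ℋ(𝔖_n)`.
    rcases lt_trichotomy i (n + 1 - e) with h | h | h
    · rcases Nat.lt_or_ge (i + 1) (n + 1 - e) with h' | h'
      · rw [← (hb.commute_desc_of_lt _ hi1 (by omega)).eq, ← mul_assoc]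
        exact hmem _ (mul_mem hx (T_mem_parab ⟨hi1, by omega⟩)) e he
      · have := hmem x hx (e + 1) (by omega)
        rwa [desc_succ', wprod_append, show n + 1 - (e + 1) + 1 = n + 1 - e by omega,
          show n + 1 - (e + 1) = i by omega, wprod_cons, wprod_nil, mul_one] at this
    · obtain ⟨c, rfl⟩ : ∃ c, e = c + 1 := ⟨e - 1, by omega⟩
      have h2 := hmem x hx c (by omega)
      have h3 := hmem x hx (c + 1) (by omega)
      rw [desc_succ', wprod_append, show n + 1 - (c + 1) + 1 = n + 1 - c by omega,
        show n + 1 - (c + 1) = i by omega, wprod_cons, wprod_nil, mul_one] at h3 ⊢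
      rw [mul_assoc, T_sq q u r hi1 (by omega), mul_add, mul_smul_comm, mul_smul_comm, mul_one,
        mul_add, mul_smul_comm, mul_smul_comm]
      exact N.add_mem (N.smul_mem _ h3) (N.smul_mem _ h2)
    · obtain ⟨i, rfl⟩ : ∃ c, i = c + 1 := ⟨i - 1, by omega⟩
      rw [hb.desc_mul (by omega) (by omega) (by omega), ← mul_assoc]
      exact hmem _ (mul_mem hx (T_mem_parab ⟨by omega, by omega⟩)) e he

theorem commute_heckeA_piPoly {n : ℕ} {c : Fin m → ℕ} {h : Alg q u r}
    (hh : h ∈ heckeA q u r n) (hc : ∀ j, c j = 0 ∨ n ≤ c j) :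
    Commute h (evalL q u r (piPoly u c)) :=
  commute_of_mem_parab (fun i hi => commute_T_piPoly q u r hi.1 fun j => by
    have := hc j
    have := hi.1
    have := hi.2
    omega) hh

theorem evalL_piPoly_one (hr : 0 < r) : evalL q u r (piPoly u fun _ => 1) = 0 := by
  rw [← cyclotomic q u r hr]
  simp only [piPoly, Finset.range_one, Finset.prod_singleton]
  rw [← List.prod_ofFn, map_list_prod, List.map_ofFn]
  congr 2
  funext k
  simp [L]

theorem evalL_eq_zero_of_dvd (hr : 0 < r) {f : MvPolynomial ℕ R}
    (h : (piPoly u fun _ => 1) ∣ f) : evalL q u r f = 0 := by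
  obtain ⟨g, rfl⟩ := h
  rw [map_mul, evalL_piPoly_one hr, zero_mul]

theorem piPoly_mul (c d : Fin m → ℕ) (h : ∀ j, c j = 0 ∨ d j = 0) :
    piPoly u c * piPoly u d = piPoly u (c + d) := by
  rw [piPoly, piPoly, piPoly, ← Finset.prod_mul_distrib]
  refine Finset.prod_congr rfl fun j _ => ?_
  rcases h j with h | h <;> simp [h]

open Classical in
/-- `π_c(u_j)` for `j ∈ S` multiplied together. -/
noncomputable abbrev piSet (u : Fin m → R) (S : Set (Fin m)) (c : ℕ) : MvPolynomial ℕ R :=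
  piPoly u fun j => if j ∈ S then c else 0

/-- With both exponents positive, every `L_1 - u_j` occurs, so the cyclotomic relation applies. -/
theorem piSet_mul_eq_zero (hr : 0 < r) {S : Set (Fin m)} {c d : ℕ} (hc : 1 ≤ c) (hd : 1 ≤ d) :
    evalL q u r (piSet u S c * piSet u Sᶜ d) = 0 := by
  apply evalL_eq_zero_of_dvd hr
  rw [piPoly_mul _ _ fun j => by by_cases hj : j ∈ S <;> simp [hj]]
  refine piPoly_dvd u fun j => ?_
  by_cases hj : j ∈ S <;> simp [hj, hc, hd]

/-- Induction on `n`: splitting a segment off `h` costs one factor per index of the right-hand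
product, so both `n` and `d` drop by one and `n < c + d` survives. -/
theorem piSet_vanish {n : ℕ} (hn : n ≤ r) {S : Set (Fin m)} {c d : ℕ} (hc : c ≤ n) (hd : d ≤ n)
    (hcd : n < c + d) {h : Alg q u r} (hh : h ∈ heckeA q u r n) :
    evalL q u r (piSet u S c) * h * evalL q u r (piSet u Sᶜ d) = 0 := by
  induction n generalizing d h with
  | zero => omega
  | succ n ih =>
    -- For `c = n + 1` the left factor commutes with all of `ℋ(𝔖_{n+1})` and meets the right factor
    -- directly.
    rcases Nat.eq_or_lt_of_le hc with rfl | hc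
    · rw [← (commute_heckeA_piPoly hh fun j => ?_).eq, mul_assoc, ← map_mul,
        piSet_mul_eq_zero (by omega) (by omega) (by omega), mul_zero]
      split_ifs <;> simp
    obtain ⟨d, rfl⟩ : ∃ d', d = d' + 1 := ⟨d - 1, by omega⟩
    -- the main case, in which the letters are all at least `d + 1`
    have key : ∀ x ∈ heckeA q u r n, ∀ k e, d + 1 ≤ k →
        evalL q u r (piSet u S c) * (x * wprod (T q u r) (desc k e)) *
          evalL q u r (piSet u Sᶜ (d + 1)) = 0 := by
      intro x hx k e hk
      obtain ⟨g, hg⟩ : piSet u Sᶜ d ∣ piSet u Sᶜ (d + 1) :=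
        piPoly_dvd u fun j => by dsimp only; split_ifs <;> omega
      have hcomm : Commute (wprod (T q u r) (desc k e)) (evalL q u r (piSet u Sᶜ d)) := by
        refine (commute_wprod fun i hi => (commute_T_piPoly q u r ?_ fun j => ?_).symm).symm
        · have := mem_desc.1 hi; omega
        · have := mem_desc.1 hi
          split_ifs <;> omega
      rw [hg, map_mul, ← mul_assoc _ x, mul_assoc (_ * x), ← mul_assoc (wprod _ _), hcomm.eq,
        ← mul_assoc, ← mul_assoc, ih (by omega) (by omega) (by omega) (by omega) hx, zero_mul,
        zero_mul]
    have hspan := mem_span_of_mem_heckeA_succ hn hh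
    clear hh
    induction hspan using Submodule.span_induction with
    | zero => rw [mul_zero, zero_mul]
    | add x y _ _ h1 h2 => rw [mul_add, add_mul, h1, h2, add_zero]
    | smul c x _ h1 => rw [mul_smul_comm, smul_mul_assoc, h1, smul_zero]
    | mem x hx =>
      obtain ⟨x, hx, e, he, rfl⟩ := hx
      rcases Nat.lt_or_ge d (n + 1 - e) with hk | hk
      · exact key x hx _ _ hk
      · have h1 : desc (n + 1 - e) e =
            desc (d + 1) (n - d) ++ desc (n + 1 - e) (d + e - n) := by
          have := desc_add (n + 1 - e) (d + e - n) (n - d)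
          rwa [show n + 1 - e + (d + e - n) = d + 1 by omega,
            show d + e - n + (n - d) = e by omega] at this
        have hcomm : Commute (wprod (T q u r) (desc (n + 1 - e) (d + e - n)))
            (evalL q u r (piSet u Sᶜ (d + 1))) := by
          refine (commute_wprod fun i hi => (commute_T_piPoly q u r ?_ fun j => ?_).symm).symm
          · have := mem_desc.1 hi; omega
          · have := mem_desc.1 hi
            split_ifs <;> omega
        rw [h1, wprod_append, ← mul_assoc x, mul_assoc, mul_assoc (x * _), hcomm.eq,
          ← mul_assoc, ← mul_assoc, key x hx _ _ le_rfl, zero_mul]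

/-- The vanishing lemma. -/
theorem piPoly_vanish {n : ℕ} (hn : n ≤ r) {S : Set (Fin m)} {x y : ℕ} (hx : x ≤ n) (hy : y ≤ n)
    (hxy : n < x + y) {c d : Fin m → ℕ} (hc : ∀ j ∈ S, x ≤ c j) (hd : ∀ j ∉ S, y ≤ d j)
    {h : Alg q u r} (hh : h ∈ heckeA q u r n) :
    evalL q u r (piPoly u c) * h * evalL q u r (piPoly u d) = 0 := by
  obtain ⟨f, hf⟩ : piSet u S x ∣ piPoly u c := piPoly_dvd u fun j => by
    by_cases hj : j ∈ S <;> simp [hj, hc]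
  obtain ⟨g, hg⟩ : piSet u Sᶜ y ∣ piPoly u d := piPoly_dvd u fun j => by
    by_cases hj : j ∈ S <;> simp [hj, hd]
  rw [hf, mul_comm, hg, map_mul, map_mul, mul_assoc (evalL q u r f), mul_assoc (evalL q u r f),
    ← mul_assoc _ _ (evalL q u r g), piSet_vanish hn hx hy hxy hh, zero_mul, mul_zero]

/-- Moving a letter from the left to the right of a product of the `π_c(u_j)`. -/
theorem exists_T_mul_piPoly {i : ℕ} (hi : 1 ≤ i) {c d : Fin m → ℕ} (hcd : c ≤ d)
    (hc : ∀ j, c j ≠ i) :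
    ∃ y, T q u r i * evalL q u r (piPoly u d) = evalL q u r (piPoly u c) * y := by
  obtain ⟨g, hg⟩ := piPoly_dvd u hcd
  refine ⟨T q u r i * evalL q u r g, ?_⟩
  rw [hg, map_mul, ← mul_assoc, (commute_T_piPoly q u r hi hc).eq, mul_assoc]

/-- A letter `i` is obstructed only by exponents equal to `i`, and giving up one factor removes the
obstruction. The letters act in increasing order `k, k + 1, …`, so a lowered exponent is not hit
again. -/
theorem exists_desc_mul_piPoly {k : ℕ} (hk : 1 ≤ k) (e : ℕ) (d : Fin m → ℕ) :
    ∃ y, wprod (T q u r) (desc k e) * evalL q u r (piPoly u d) =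
      evalL q u r (piPoly u fun j => if k ≤ d j ∧ d j < k + e then d j - 1 else d j) * y := by
  induction e with
  | zero =>
    refine ⟨1, ?_⟩
    have : (fun j => if k ≤ d j ∧ d j < k + 0 then d j - 1 else d j) = d := by
      funext j
      rw [if_neg (by omega)]
    rw [this]
    simp [desc]
  | succ e ih =>
    obtain ⟨y, hy⟩ := ih
    obtain ⟨z, hz⟩ := exists_T_mul_piPoly (q := q) (u := u) (r := r) (i := k + e) (by omega)
      (c := fun j => if k ≤ d j ∧ d j < k + (e + 1) then d j - 1 else d j)
      (d := fun j => if k ≤ d j ∧ d j < k + e then d j - 1 else d j)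
      (fun j => by dsimp only; split_ifs <;> omega) (fun j => by split_ifs <;> omega)
    exact ⟨z * y, by rw [desc, wprod_cons, mul_assoc, hy, ← mul_assoc, hz, mul_assoc]⟩

end Poly

end ArikiKoike
namespace ArikiKoike

/-! ### Factorization through `T_{w_𝐚}` by induction on the truncation -/

section Main

open MvPolynomial

variable {R : Type*} [CommRing R] {m : ℕ} {q : Rˣ} {u : Fin m → R} {r : ℕ}

/-- The exponents of `π_𝐚`, truncated to `{1, …, n}`. -/
def lft (a : Lam m r) (n : ℕ) (j : Fin m) : ℕ := min (a j.castSucc) n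

/-- The exponents of `π̃_{𝐚'}`, truncated to `{1, …, n}`. -/
def rgt (a : Lam m r) (n : ℕ) (j : Fin m) : ℕ := n - a j.succ

/-- The indices of the generators of the Young subgroup of `𝐚'`, truncated to `{1, …, n}`. -/
def dualIdx (a : Lam m r) (n : ℕ) : Set ℕ := {i | 1 ≤ i ∧ i < n ∧ ∀ k, i ≠ n - a k}

open Classical in
/-- The left end `a_{p-1}` of the block containing `n + 1`. -/
noncomputable def bot (a : Lam m r) (n : ℕ) : ℕ :=
  if h : ∃ j, n + 1 ∈ a.block j then a h.choose.castSucc else 0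

theorem bot_of_mem {a : Lam m r} {n : ℕ} {j : Fin m} (hj : n + 1 ∈ a.block j) :
    bot a n = a j.castSucc := by
  have h : ∃ j, n + 1 ∈ a.block j := ⟨j, hj⟩
  rw [bot, dif_pos h, a.block_unique h.choose_spec hj]

theorem bot_le (a : Lam m r) (n : ℕ) : bot a n ≤ n := by
  by_cases h : ∃ j, n + 1 ∈ a.block j
  · obtain ⟨j, hj⟩ := h
    rw [bot_of_mem hj]
    exact Nat.lt_succ_iff.1 hj.1
  · rw [bot, dif_neg h]
    exact Nat.zero_le _

theorem Lam.le_or_ge (a : Lam m r) (p : Fin m) (k : Fin (m + 1)) :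
    a k ≤ a p.castSucc ∨ a p.succ ≤ a k := by
  rcases lt_or_ge k p.succ with h | h
  · exact Or.inl (a.mono' (Fin.le_castSucc_iff.2 h))
  · exact Or.inr (a.mono' h)

theorem mem_block {a : Lam m r} {j : Fin m} {x : ℕ} :
    x ∈ a.block j ↔ a j.castSucc < x ∧ x ≤ a j.succ := Iff.rfl

variable (q u) in
/-- The element `T_{w_𝐚}`, truncated to `{1, …, n}`. -/
noncomputable def wElt (a : Lam m r) (n : ℕ) : Alg q u r := wprod (T q u r) (canWord (bot a) n)

theorem wElt_succ (a : Lam m r) (n : ℕ) :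
    wElt q u a (n + 1) = wElt q u a n * wprod (T q u r) (desc (n + 1 - bot a n) (bot a n)) := by
  rw [wElt, canWord, wprod_append, wElt]

theorem wElt_mem (a : Lam m r) (n : ℕ) : wElt q u a n ∈ heckeA q u r n :=
  wprod_mem_parab fun _ hi => mem_canWord (bot_le a) hi

theorem commute_rgt {a : Lam m r} {n : ℕ} {h : Alg q u r} (hh : h ∈ parab q u r (dualIdx a n)) :
    Commute h (evalL q u r (piPoly u (rgt a n))) :=
  commute_of_mem_parab (fun _ hi => commute_T_piPoly q u r hi.1 fun j => (hi.2.2 j.succ).symm) hh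

theorem exists_lft_succ (a : Lam m r) (n : ℕ) :
    ∃ y : Alg q u r, evalL q u r (piPoly u (lft a (n + 1))) =
      y * evalL q u r (piPoly u (lft a n)) := by
  obtain ⟨f, hf⟩ := piPoly_dvd u (c := lft a n) (d := lft a (n + 1)) fun j => by
    simp only [lft]; omega
  exact ⟨evalL q u r f, by rw [hf, mul_comm, map_mul]⟩

/-- The heart of (a). Truncating every ingredient to `{1, …, n}` makes induction possible: passing
to `n + 1` multiplies `T_{w_𝐚}` by one descending segment, of length the left end of the block of `n
+ 1`. -/
theorem lft_mul_mul_rgt {a : Lam m r} {n : ℕ} (hn : n ≤ r) {h : Alg q u r}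
    (hh : h ∈ heckeA q u r n) :
    ∃ h' ∈ parab q u r (dualIdx a n),
      evalL q u r (piPoly u (lft a n)) * h * evalL q u r (piPoly u (rgt a n)) =
        evalL q u r (piPoly u (lft a n)) * wElt q u a n * evalL q u r (piPoly u (rgt a n)) * h' := by
  induction n generalizing h with
  | zero =>
    have hcom : Commute h (evalL q u r (piPoly u (rgt a 0))) :=
      commute_of_mem_parab (fun _ hi => by have := hi.2; omega) hh
    refine ⟨h, parab_mono (fun _ hi => by have := hi.2; omega) hh, ?_⟩
    rw [mul_assoc, hcom.eq]
    simp [wElt, canWord, mul_assoc]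
  | succ n ih =>
    obtain ⟨p, hp⟩ := a.exists_block (Nat.le_add_left 1 n) hn
    rw [wElt_succ, bot_of_mem hp]
    rw [mem_block] at hp
    obtain ⟨hp1, hp2⟩ := hp
    have hsep := a.le_or_ge p
    have hb := T_braidRel q u r
    obtain ⟨E, hE⟩ := exists_lft_succ (q := q) (u := u) a n
    set b := n + 1 - a p.castSucc
    -- the terms with a segment ending in the first block of `𝐚'`
    have key : ∀ x ∈ heckeA q u r n, ∃ h' ∈ parab q u r (dualIdx a (n + 1)),
        evalL q u r (piPoly u (lft a (n + 1))) * (x * wprod (T q u r) (desc b (a p.castSucc))) *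
          evalL q u r (piPoly u (rgt a (n + 1))) =
        evalL q u r (piPoly u (lft a (n + 1))) *
          (wElt q u a n * wprod (T q u r) (desc b (a p.castSucc))) *
          evalL q u r (piPoly u (rgt a (n + 1))) * h' := by
      intro x hx
      obtain ⟨h', hh', e1⟩ := ih (by omega) hx
      obtain ⟨y, hy⟩ := exists_desc_mul_piPoly (q := q) (u := u) (r := r)
        (k := b) (by omega) (a p.castSucc) (rgt a (n + 1))
      -- Exponents `n + 1 - a_j` of blocks before the `p`-th are at least `b`, so they drop to `n -
      -- a_j`, or stay at `n + 1` if `a_j = 0`; the others are `0`. In all cases `rgt a n` survives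
      -- as a divisor.
      obtain ⟨g, hg⟩ := piPoly_dvd u (c := rgt a n) (d := fun j =>
        if b ≤ rgt a (n + 1) j ∧ rgt a (n + 1) j < b + a p.castSucc then rgt a (n + 1) j - 1
        else rgt a (n + 1) j) fun j => by
          have := hsep j.succ
          have h1 : rgt a n j = n - a j.succ := rfl
          have h2 : rgt a (n + 1) j = n + 1 - a j.succ := rfl
          dsimp only
          split_ifs <;> omega
      rw [hg, map_mul] at hy
      -- Letters below `b - 1` commute with the segment and those from `b` on are raised by one; the
      -- obstructing letter `b - 1 = n - a_{p-1}` is not in `dualIdx a n`.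
      obtain ⟨h'', hh'', e2⟩ : ∃ h'' ∈ parab q u r (dualIdx a (n + 1)),
          h' * wprod (T q u r) (desc b (a p.castSucc)) =
            wprod (T q u r) (desc b (a p.castSucc)) * h'' := by
        refine exists_mul_eq_of_mem_adjoin' ?_ hh'
        rintro _ ⟨i, ⟨hi1, hi2, hi3⟩, rfl⟩
        have h0 := hi3 p.castSucc
        rcases Nat.lt_or_ge i b with h | h
        · refine ⟨T q u r i, T_mem_parab ⟨hi1, by omega, fun k => ?_⟩,
            (hb.commute_desc_of_lt _ hi1 (by omega)).eq⟩
          have := hsep k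
          omega
        · refine ⟨T q u r (i + 1), T_mem_parab ⟨by omega, by omega, fun k => ?_⟩,
            (hb.desc_mul (by omega) h (by omega)).symm⟩
          have := hi3 k
          omega
      refine ⟨h'', hh'', ?_⟩
      rw [mul_assoc _ _ h', ← (commute_rgt hh').eq] at e1
      set P := evalL q u r (piPoly u (lft a n))
      set Q := evalL q u r (piPoly u (rgt a n))
      set D := wprod (T q u r) (desc b (a p.castSucc))
      set Q' := evalL q u r (piPoly u (rgt a (n + 1)))
      rw [hE]
      -- The relation `hy` is used twice: forwards to expose `Q` for the induction hypothesis, then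
      -- backwards to restore `D * Q'`.
      calc E * P * (x * D) * Q' = E * (P * x * Q) * (evalL q u r g * y) := by
            simp only [mul_assoc]; rw [hy]; simp only [mul_assoc]
        _ = E * P * wElt q u a n * (h' * D) * Q' := by
            rw [e1]; simp only [mul_assoc]; rw [hy]; simp only [mul_assoc]
        _ = E * P * (wElt q u a n * D) * Q' * h'' := by
            rw [e2]; simp only [mul_assoc]; rw [(commute_rgt hh'').eq]
    have hspan := mem_span_of_mem_heckeA_succ hn hh
    clear hh
    induction hspan using Submodule.span_induction with
    | zero => exact ⟨0, zero_mem _, by simp⟩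
    | add x y _ _ h1 h2 =>
      obtain ⟨x', hx', h1⟩ := h1
      obtain ⟨y', hy', h2⟩ := h2
      exact ⟨x' + y', add_mem hx' hy', by rw [mul_add, add_mul, h1, h2, mul_add]⟩
    | smul c x _ h1 =>
      obtain ⟨x', hx', h1⟩ := h1
      exact ⟨c • x', Subalgebra.smul_mem _ hx' c,
        by rw [mul_smul_comm, smul_mul_assoc, h1, mul_smul_comm]⟩
    | mem x hx =>
      obtain ⟨x, hx, e, he, rfl⟩ := hx
      -- Too short a segment leaves right exponents at least `b` for all blocks before the `p`-th.
      -- Since `a_{p-1} + b = n + 1 > n`, the vanishing lemma applies. In a long segment the surplus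
      -- letters lie below `b`, inside the first block of the truncated `𝐚'`.
      rcases Nat.lt_or_ge e (a p.castSucc) with hlt | hge
      · refine ⟨0, zero_mem _, ?_⟩
        obtain ⟨y, hy⟩ := exists_desc_mul_piPoly (q := q) (u := u) (r := r)
          (k := n + 1 - e) (by omega) e (rgt a (n + 1))
        rw [mul_zero, ← mul_assoc _ x, mul_assoc, hy, hE, ← mul_assoc, mul_assoc E, mul_assoc E,
          piPoly_vanish (S := {j | a p.castSucc ≤ a j.castSucc}) (x := a p.castSucc) (y := b)
            (by omega) (by omega) (by omega) (by omega) ?_ ?_ hx, mul_zero, zero_mul]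
        · intro j hj
          simp only [lft, Set.mem_ofPred_eq] at hj ⊢
          omega
        · intro j hj
          simp only [Set.mem_ofPred_eq, not_le] at hj
          have h1 := a.le_or_ge j p.castSucc
          have h2 : rgt a (n + 1) j = n + 1 - a j.succ := rfl
          split_ifs <;> omega
      · obtain ⟨h', hh', e1⟩ := key x hx
        have hdesc : desc (n + 1 - e) e =
            desc b (a p.castSucc) ++ desc (n + 1 - e) (e - a p.castSucc) := by
          have := desc_add (n + 1 - e) (e - a p.castSucc) (a p.castSucc)
          rwa [show n + 1 - e + (e - a p.castSucc) = b by omega,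
            show e - a p.castSucc + a p.castSucc = e by omega] at this
        have hD : wprod (T q u r) (desc (n + 1 - e) (e - a p.castSucc)) ∈
            parab q u r (dualIdx a (n + 1)) := wprod_mem_parab fun i hi => by
          have := mem_desc.1 hi
          refine ⟨by omega, by omega, fun k => ?_⟩
          have := hsep k
          omega
        refine ⟨_, mul_mem hh' hD, ?_⟩
        rw [← mul_assoc _ h', ← e1, hdesc, wprod_append, mul_assoc _ _ (wprod _ _),
          ← (commute_rgt hD).eq]
        simp only [mul_assoc]

/-- `T_{w_𝐚} T_{(x) w_𝐚} = T_x T_{w_𝐚}` if `x` and `x + 1` lie in the same block. -/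
theorem wElt_mul_T {a : Lam m r} {n x : ℕ} {k : Fin m} (hx : a k.castSucc < x)
    (hx' : x + 1 ≤ a k.succ) (hn : x + 1 ≤ n) (hr : n ≤ r) :
    wElt q u a n * T q u r (n - a k.succ + (x - a k.castSucc)) =
      T q u r x * wElt q u a n := by
  have hb := T_braidRel q u r
  induction n with
  | zero => omega
  | succ n ih =>
    obtain ⟨p, hp⟩ := a.exists_block (Nat.le_add_left 1 n) hr
    rw [wElt_succ, bot_of_mem hp]
    obtain ⟨hp1, hp2⟩ := mem_block.1 hp
    have hs1 := a.le_or_ge p k.castSucc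
    have hs2 := a.le_or_ge p k.succ
    have hs3 := a.le_or_ge k p.castSucc
    rcases Nat.lt_or_ge x n with hxn | hxn
    · have ih := ih (by omega) (by omega)
      rcases Nat.lt_or_ge n (a k.succ) with h | h
      · rw [mul_assoc, ← (hb.commute_desc_of_lt _ (by omega) (by omega)).eq, ← mul_assoc,
          show n + 1 - a k.succ + (x - a k.castSucc) = n - a k.succ + (x - a k.castSucc) by omega,
          ih, mul_assoc]
      · rw [mul_assoc, show n + 1 - a k.succ + (x - a k.castSucc) =
          n - a k.succ + (x - a k.castSucc) + 1 by omega, hb.desc_mul (by omega) (by omega)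
            (by omega), ← mul_assoc, ih, mul_assoc]
    · obtain rfl : x = n := by omega
      obtain ⟨x, rfl⟩ : ∃ c, x = c + 1 := ⟨x - 1, by omega⟩
      obtain rfl : p = k := a.block_unique hp (mem_block.2 ⟨by omega, hx'⟩)
      have hp' : x + 1 ∈ a.block p := mem_block.2 ⟨by omega, by omega⟩
      rw [wElt_succ, bot_of_mem hp']
      set c := a p.castSucc
      have h1 : Commute (T q u r (x + 1)) (wElt q u a x) :=
        (commute_of_mem_parab (fun i hi => hb.comm i (x + 1) hi.1 (by have := hi.2; omega))
          (wElt_mem a x)).symm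
      rw [show x + 1 + 1 - a p.succ + (x + 1 - c) = x + 1 - c by omega,
        show x + 1 + 1 - c = x + 1 - c + 1 by omega]
      set k := x + 1 - c
      have h2 : wprod (T q u r) (desc (k + 1) c) * T q u r k = wprod (T q u r) (desc k (c + 1)) := by
        rw [desc_succ', wprod_append, wprod_cons, wprod_nil, mul_one]
      have h3 : T q u r (x + 1) * wprod (T q u r) (desc k c) = wprod (T q u r) (desc k (c + 1)) := by
        rw [desc, wprod_cons, show k + c = x + 1 by omega]
      rw [mul_assoc, h2, mul_assoc, ← hb.desc_mul_desc (by omega) (Nat.lt_succ_self c), ← h3,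
        ← mul_assoc, ← mul_assoc, ← mul_assoc, ← mul_assoc, h1.eq]

/-- The values of the permutation of the canonical word of `w_𝐚`, truncated to `{1, …, n}`. -/
theorem wordPerm_canWord {a : Lam m r} {n x : ℕ} (hn : n ≤ r) (hx : x ≤ n) {j : Fin m}
    (hj : x ∈ a.block j) :
    wordPerm (canWord (bot a) n) x = n - a j.succ + (x - a j.castSucc) := by
  obtain ⟨hj1, hj2⟩ := mem_block.1 hj
  induction n with
  | zero => omega
  | succ n ih =>
    obtain ⟨p, hp⟩ := a.exists_block (Nat.le_add_left 1 n) hn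
    have hp' := mem_block.1 hp
    have hs1 := a.le_or_ge p j.castSucc
    have hs2 := a.le_or_ge p j.succ
    have hs3 := a.le_or_ge j p.castSucc
    rw [canWord, wordPerm_append, Equiv.Perm.mul_apply, bot_of_mem hp, wordPerm_desc]
    rcases Nat.lt_or_ge n x with h | h
    · obtain rfl : x = n + 1 := by omega
      obtain rfl := a.block_unique hp hj
      rw [wordPerm_mem_sym (fun i hi => mem_canWord (bot_le a) hi) (n + 1) (by simp),
        if_pos (by omega)]
      omega
    · rw [ih (by omega) h]
      split_ifs <;> omega

theorem wordPerm_canWord_eq (a : Lam m r) : wordPerm (canWord (bot a) r) = wPerm a := by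
  ext x
  by_cases hx : x ∈ Set.Icc 1 r
  · obtain ⟨j, hj⟩ := a.exists_block hx.1 hx.2
    rw [wordPerm_canWord le_rfl hx.2 hj]
    exact (wFun_of_mem a hj).symm
  · rw [wordPerm_mem_sym (fun i hi => mem_canWord (bot_le a) hi) x hx, (wPerm a).2 x hx]

/-- The chosen reduced word may be replaced by the canonical word of the same permutation, without a
separate proof that the latter is reduced. -/
theorem Tw_wPerm (a : Lam m r) : Tw q u (wPerm a) = wElt q u a r :=
  wprod_eq_of_isReduced (T_braidRel q u r) (exists_reduced (wPerm a)).choose_spec (bot_le a)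
    (wordPerm_canWord_eq a)

end Main

end ArikiKoike
namespace ArikiKoike

/-! ### Spanning of `𝐇` by products of polynomials in the `L_i` with `ℋ` -/

section Spanning

open MvPolynomial

variable {R : Type*} [CommRing R] {m : ℕ} (q : Rˣ) (u : Fin m → R) (r : ℕ)

theorem mk_mem_adjoin (x : FreeAlgebra R (Fin r)) :
    mk q u r x ∈ Algebra.adjoin R (T q u r '' Set.Iio r) := by
  induction x using FreeAlgebra.induction with
  | grade0 c => rw [AlgHom.commutes]; exact Subalgebra.algebraMap_mem _ c
  | grade1 i => exact Algebra.subset_adjoin ⟨i, i.2, T_of_lt q u r i.2⟩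
  | mul x y hx hy => rw [map_mul]; exact mul_mem hx hy
  | add x y hx hy => rw [map_add]; exact add_mem hx hy

theorem exists_T_mul_evalL {i : ℕ} (h1 : 1 ≤ i) (h2 : i < r) (f : MvPolynomial ℕ R) :
    ∃ g h : MvPolynomial ℕ R,
      T q u r i * evalL q u r f = evalL q u r g * T q u r i + evalL q u r h := by
  induction f using MvPolynomial.induction_on with
  | C x => exact ⟨C x, 0, by rw [evalL_C, map_zero, add_zero, Algebra.commutes]⟩
  | add f f' hf hf' =>
    obtain ⟨g, h, e⟩ := hf
    obtain ⟨g', h', e'⟩ := hf'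
    refine ⟨g + g', h + h', ?_⟩
    rw [map_add, mul_add, e, e', map_add, map_add, add_mul]
    abel
  | mul_X f j hf =>
    obtain ⟨g, h, e⟩ := hf
    obtain ⟨g', h', e'⟩ : ∃ g h : MvPolynomial ℕ R,
        T q u r i * L q u r j = evalL q u r g * T q u r i + evalL q u r h := by
      by_cases hj : j = i
      · subst hj
        refine ⟨X (j + 1), C (1 - (q : R)) * X (j + 1), ?_⟩
        rw [T_mul_L q u r h1 h2, map_mul, evalL_C, evalL_X, ← Algebra.smul_def, sub_eq_add_neg,
          ← neg_smul, neg_sub]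
      by_cases hj' : j = i + 1
      · subst hj'
        refine ⟨X i, C ((q : R) - 1) * X (i + 1), ?_⟩
        rw [T_mul_L_succ q u r h1 h2, map_mul, evalL_C, evalL_X, evalL_X, ← Algebra.smul_def]
      · refine ⟨X j, 0, ?_⟩
        rw [map_zero, add_zero, evalL_X, (commute_T_L q u r h1 hj hj').eq]
    refine ⟨g * g', g * h' + h * X j, ?_⟩
    rw [map_mul, ← mul_assoc, e, add_mul, evalL_X, mul_assoc, e', map_add, map_mul, map_mul,
      map_mul, evalL_X, mul_add, mul_assoc, add_assoc]

/-- `𝐇` is spanned by the products of polynomials in the `L_i` with elements of `ℋ`. -/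
theorem mem_span_evalL_mul (x : Alg q u r) :
    x ∈ Submodule.span R {y | ∃ f : MvPolynomial ℕ R, ∃ h ∈ heckeA q u r r,
      y = evalL q u r f * h} := by
  set N := Submodule.span R {y | ∃ f : MvPolynomial ℕ R, ∃ h ∈ heckeA q u r r,
      y = evalL q u r f * h}
  obtain ⟨x, rfl⟩ := mk_surjective q u r x
  have h1 : (1 : Alg q u r) ∈ N := Submodule.subset_span ⟨1, 1, one_mem _, by simp⟩
  rw [← mul_one (mk q u r x)]
  refine mul_mem_of_mem_adjoin_left ?_ h1 (mk_mem_adjoin q u r x)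
  rintro x hx _ ⟨i, hi, rfl⟩
  induction hx using Submodule.span_induction with
  | zero => rw [mul_zero]; exact N.zero_mem
  | add x y _ _ hx hy => rw [mul_add]; exact N.add_mem hx hy
  | smul c x _ hx => rw [mul_smul_comm]; exact N.smul_mem c hx
  | mem x hx =>
    obtain ⟨f, h, hh, rfl⟩ := hx
    rcases Nat.eq_zero_or_pos i with rfl | hi0
    · refine Submodule.subset_span ⟨X 1 * f, h, hh, ?_⟩
      rw [map_mul, evalL_X, ← mul_assoc]; rfl
    · obtain ⟨g, g', e⟩ := exists_T_mul_evalL q u r hi0 hi f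
      rw [← mul_assoc, e, add_mul, mul_assoc]
      exact N.add_mem
        (Submodule.subset_span ⟨g, _, mul_mem (T_mem_parab ⟨hi0, hi⟩) hh, rfl⟩)
        (Submodule.subset_span ⟨g', h, hh, rfl⟩)

theorem L_of_lt {i : ℕ} (h : r < i) : L q u r i = 0 := by
  obtain ⟨i, rfl⟩ : ∃ c, i = c + 1 := ⟨i - 1, by omega⟩
  rcases Nat.eq_zero_or_pos i with rfl | hi
  · exact T_of_le q u r (by omega)
  · rw [L_succ q u r hi, T_of_le q u r (by omega), mul_zero, smul_zero]

end Spanning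

/-! ### Translation of the given definitions into exponents and index sets -/

section Bridge

open MvPolynomial

variable {R : Type*} [CommRing R] {m : ℕ} {q : Rˣ} {u : Fin m → R} {r : ℕ}

theorem piOne_eq (c : ℕ) (x : R) :
    piOne q u r c x = evalL q u r (∏ i ∈ Finset.range c, (X (i + 1) - C x)) := by
  induction c with
  | zero => simp [piOne]
  | succ c ih =>
    rw [Finset.prod_range_succ, map_mul, ← ih, piOne, piOne, List.range_succ, List.map_append,
      List.prod_append]
    simp

theorem piA_eq (a : Lam m r) : piA q u a = evalL q u r (piPoly u (lft a r)) := by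
  rw [piPoly, ← List.prod_ofFn, map_list_prod, List.map_ofFn, piA]
  congr 2
  funext j
  rw [piOne_eq, Function.comp, lft, min_eq_left (a.le _)]

theorem piTilde_eq (a : Lam m r) :
    piTilde q u a.dual = evalL q u r (piPoly u (rgt a r)) := by
  have h : piTilde q u a.dual = evalL q u r (∏ j : Fin m,
      ∏ i ∈ Finset.range (a.dual j.castSucc), (X (i + 1) - C (u j.rev))) := by
    rw [← List.prod_ofFn, map_list_prod, List.map_ofFn, piTilde]
    congr 2
    funext j
    rw [piOne_eq, Function.comp]
  rw [h, piPoly]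
  congr 1
  -- Reversing the block index matches the reversed parameters of `π̃` with the complemented
  -- exponents `r - a_j`.
  refine Fintype.prod_equiv Fin.revPerm _ _ fun j => ?_
  simp [Lam.dual, rgt, Fin.rev_castSucc]

theorem s_mem_sym_iff {i n : ℕ} (hi : 1 ≤ i) : s i ∈ sym n ↔ i < n := by
  refine ⟨fun h => ?_, fun h => s_mem_sym hi h⟩
  by_contra hn
  have := h (i + 1) (by simp only [Set.mem_Icc]; omega)
  rw [s, Equiv.swap_apply_right] at this
  omega

theorem hecke_eq_parab (P : Subgroup (Equiv.Perm ℕ)) :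
    hecke q u r P = parab q u r {i | 1 ≤ i ∧ i < r ∧ s i ∈ P} := by
  unfold hecke parab
  congr 1
  ext t
  constructor
  · rintro ⟨i, h1, h2, h3, rfl⟩
    exact ⟨i, ⟨h1, h2, h3⟩, rfl⟩
  · rintro ⟨i, ⟨h1, h2, h3⟩, rfl⟩
    exact ⟨i, h1, h2, h3, rfl⟩

theorem hecke_sym {n : ℕ} (hn : n ≤ r) : hecke q u r (sym n) = heckeA q u r n := by
  rw [hecke_eq_parab]
  congr 1
  ext i
  constructor
  · rintro ⟨h1, -, h3⟩
    exact ⟨h1, (s_mem_sym_iff h1).1 h3⟩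
  · rintro ⟨h1, h2⟩
    exact ⟨h1, by omega, (s_mem_sym_iff h1).2 h2⟩

theorem s_mem_young_iff (a : Lam m r) {i : ℕ} (h1 : 1 ≤ i) (h2 : i < r) :
    s i ∈ young a ↔ ∀ k, i ≠ a k := by
  constructor
  · rintro ⟨-, h⟩ k rfl
    obtain ⟨j, hj⟩ := a.exists_block h1 h2.le
    have h3 := (h j (a k)).2 hj
    rw [s, Equiv.swap_apply_left] at h3
    rw [mem_block] at hj h3
    have := a.le_or_ge j k
    omega
  · intro h
    refine ⟨s_mem_sym h1 h2, fun j x => ?_⟩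
    have h3 := h j.castSucc
    have h4 := h j.succ
    rw [mem_block, mem_block, s, Equiv.swap_apply_def]
    split_ifs <;> omega

/-- The indices of the generators of the Young subgroup of `𝐚`. -/
def youngIdx (a : Lam m r) : Set ℕ := {i | 1 ≤ i ∧ i < r ∧ ∀ k, i ≠ a k}

theorem hecke_young (a : Lam m r) : hecke q u r (young a) = parab q u r (youngIdx a) := by
  rw [hecke_eq_parab]
  congr 1
  ext i
  exact ⟨fun h => ⟨h.1, h.2.1, (s_mem_young_iff a h.1 h.2.1).1 h.2.2⟩,
    fun h => ⟨h.1, h.2.1, (s_mem_young_iff a h.1 h.2.1).2 h.2.2⟩⟩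

theorem Lam.dual_apply (a : Lam m r) (k : Fin (m + 1)) : a.dual k = r - a k.rev := rfl

theorem dualIdx_eq (a : Lam m r) : dualIdx a r = youngIdx a.dual := by
  ext i
  refine and_congr_right fun _ => and_congr_right fun _ => ⟨fun h k => h k.rev, fun h k => ?_⟩
  have := h k.rev
  rwa [Lam.dual_apply, Fin.rev_rev] at this

theorem hecke_young_dual (a : Lam m r) :
    hecke q u r (young a.dual) = parab q u r (dualIdx a r) := by
  rw [hecke_young, dualIdx_eq]

theorem youngIdx_exists_block {a : Lam m r} {i : ℕ} (h : i ∈ youngIdx a) :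
    ∃ k : Fin m, a k.castSucc < i ∧ i + 1 ≤ a k.succ := by
  obtain ⟨h1, h2, h3⟩ := h
  obtain ⟨j, hj⟩ := a.exists_block h1 h2.le
  have := h3 j.succ
  rw [mem_block] at hj
  exact ⟨j, hj.1, by omega⟩

theorem mem_youngIdx {a : Lam m r} {x : ℕ} {k : Fin m} (h1 : a k.castSucc < x)
    (h2 : x + 1 ≤ a k.succ) : x ∈ youngIdx a := by
  have := a.le k.succ
  refine ⟨by omega, by omega, fun j => ?_⟩
  have := a.le_or_ge k j
  omega

theorem dualIdx_exists_block {a : Lam m r} {i : ℕ} (h : i ∈ dualIdx a r) :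
    ∃ k : Fin m, r - a k.succ < i ∧ i + 1 ≤ r - a k.castSucc := by
  obtain ⟨h1, h2, h3⟩ := h
  obtain ⟨k, hk⟩ := a.exists_block (x := r - i) (by omega) (by omega)
  rw [mem_block] at hk
  have := h3 k.succ
  have := a.le k.succ
  exact ⟨k, by omega, by omega⟩

theorem mem_dualIdx {a : Lam m r} {x : ℕ} {k : Fin m} (h1 : r - a k.succ < x)
    (h2 : x + 1 ≤ r - a k.castSucc) : x ∈ dualIdx a r := by
  refine ⟨by omega, by omega, fun j => ?_⟩
  have := a.le_or_ge k j
  omega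

end Bridge

/-! ### The element `v_𝐚`: intertwining, action of the `L_i`, and absorption -/

section Theorem

open MvPolynomial

variable {R : Type*} [CommRing R] {m : ℕ} {q : Rˣ} {u : Fin m → R} {r : ℕ}

theorem v_eq (a : Lam m r) : v q u a =
    evalL q u r (piPoly u (lft a r)) * wElt q u a r * evalL q u r (piPoly u (rgt a r)) := by
  rw [v, piA_eq, piTilde_eq, Tw_wPerm]

theorem v_mul_T_of_block (a : Lam m r) {x : ℕ} {k : Fin m} (h1 : a k.castSucc < x)
    (h2 : x + 1 ≤ a k.succ) :
    v q u a * T q u r (r - a k.succ + (x - a k.castSucc)) = T q u r x * v q u a := by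
  have := a.le k.succ
  have hl : Commute (T q u r x) (evalL q u r (piPoly u (lft a r))) :=
    commute_T_piPoly q u r (by omega) fun j => by
      have := a.le_or_ge k j.castSucc
      simp only [lft]
      omega
  have hr : Commute (T q u r (r - a k.succ + (x - a k.castSucc)))
      (evalL q u r (piPoly u (rgt a r))) :=
    commute_rgt (T_mem_parab (mem_dualIdx (k := k) (by omega) (by omega)))
  rw [v_eq, mul_assoc, ← hr.eq, ← mul_assoc, mul_assoc _ (wElt q u a r),
    wElt_mul_T h1 h2 (by omega) le_rfl, ← mul_assoc, ← hl.eq]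
  simp only [mul_assoc]

theorem v_mul_T (a : Lam m r) {i : ℕ} (hi : i ∈ dualIdx a r) :
    (wPerm a : Equiv.Perm ℕ)⁻¹ i ∈ youngIdx a ∧
      v q u a * T q u r i = T q u r ((wPerm a : Equiv.Perm ℕ)⁻¹ i) * v q u a := by
  obtain ⟨k, h1, h2⟩ := dualIdx_exists_block hi
  have := a.le k.succ
  have e : (wPerm a : Equiv.Perm ℕ)⁻¹ i = a k.castSucc + (i - (r - a k.succ)) := by
    rw [Equiv.Perm.inv_eq_iff_eq, wPerm_apply a k _ (by omega) (by omega)]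
    omega
  rw [e]
  refine ⟨mem_youngIdx (k := k) (by omega) (by omega), ?_⟩
  rw [← v_mul_T_of_block a (k := k) (by omega) (by omega)]
  congr 2
  omega

theorem T_mul_v (a : Lam m r) {x : ℕ} (hx : x ∈ youngIdx a) :
    ∃ i ∈ dualIdx a r, T q u r x * v q u a = v q u a * T q u r i := by
  obtain ⟨k, h1, h2⟩ := youngIdx_exists_block hx
  have := a.le k.succ
  exact ⟨_, mem_dualIdx (k := k) (by omega) (by omega), (v_mul_T_of_block a h1 h2).symm⟩

theorem v_mul_dual (a : Lam m r) {h : Alg q u r} (hh : h ∈ parab q u r (dualIdx a r)) :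
    ∃ h' ∈ parab q u r (youngIdx a), v q u a * h = h' * v q u a := by
  refine exists_mul_eq_of_mem_adjoin ?_ hh
  rintro _ ⟨i, hi, rfl⟩
  exact ⟨_, T_mem_parab (v_mul_T (q := q) (u := u) a hi).1, (v_mul_T a hi).2⟩

theorem young_mul_v (a : Lam m r) {h : Alg q u r} (hh : h ∈ parab q u r (youngIdx a)) :
    ∃ h' ∈ parab q u r (dualIdx a r), h * v q u a = v q u a * h' := by
  refine exists_mul_eq_of_mem_adjoin' ?_ hh
  rintro _ ⟨i, hi, rfl⟩
  obtain ⟨j, hj, e⟩ := T_mul_v (q := q) (u := u) a hi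
  exact ⟨_, T_mem_parab hj, e⟩

theorem piPoly_update (c : Fin m → ℕ) (k : Fin m) :
    piPoly u (Function.update c k (c k + 1)) = piPoly u c * (X (c k + 1) - C (u k)) := by
  unfold piPoly
  rw [← Finset.mul_prod_erase _ _ (Finset.mem_univ k),
    ← Finset.mul_prod_erase Finset.univ (fun j => ∏ i ∈ Finset.range (c j), _)
      (Finset.mem_univ k), Function.update_self, Finset.prod_range_succ]
  have : ∀ j ∈ Finset.univ.erase k,
      ∏ i ∈ Finset.range (Function.update c k (c k + 1) j), (X (i + 1) - C (u j)) =
        ∏ i ∈ Finset.range (c j), (X (i + 1) - C (u j) : MvPolynomial ℕ R) := fun j hj => by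
    rw [Function.update_of_ne (Finset.ne_of_mem_erase hj)]
  rw [Finset.prod_congr rfl this]
  ring

/-- The factor `L_{r-a_k+1} - u_k` raises the `k`-th right exponent by one, which is just enough for
the vanishing lemma. -/
theorem v_mul_L_first (a : Lam m r) {k : Fin m} (hk : a k.castSucc < a k.succ) :
    v q u a * L q u r (r - a k.succ + 1) = u k • v q u a := by
  have hle := a.le k.succ
  have h0 : v q u a * (L q u r (r - a k.succ + 1) - algebraMap R _ (u k)) = 0 := by
    have e : L q u r (r - a k.succ + 1) - algebraMap R _ (u k) =
        evalL q u r (X (rgt a r k + 1) - C (u k)) := by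
      rw [map_sub, evalL_X, evalL_C, rgt]
    rw [e, v_eq, mul_assoc, ← map_mul, ← piPoly_update]
    -- Left exponents after `k` are at least `a_k`; right ones up to `k` are at least `r - a_k + 1`,
    -- where for `j < k` the nonemptiness of the block is needed. The bounds add up to `r + 1`.
    refine piPoly_vanish le_rfl (S := {j | k < j}) (x := a k.succ) (y := r - a k.succ + 1)
      hle (by omega) (by omega) (fun j hj => ?_) (fun j hj => ?_) (wElt_mem a r)
    · exact le_min (a.mono' (Fin.succ_le_castSucc_iff.2 hj)) hle
    · rcases eq_or_ne j k with rfl | hjk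
      · rw [Function.update_self, rgt]
      · have := a.mono' (Fin.succ_le_castSucc_iff.2 (lt_of_le_of_ne (not_lt.1 hj) hjk))
        rw [Function.update_of_ne hjk, rgt]
        omega
  rw [mul_sub, sub_eq_zero] at h0
  rw [h0, ← Algebra.commutes, Algebra.smul_def]

theorem L_first_mul_v (a : Lam m r) {k : Fin m} (hk : a k.castSucc < a k.succ) :
    L q u r (a k.castSucc + 1) * v q u a = u k • v q u a := by
  have hle := a.le k.succ
  have h0 : (L q u r (a k.castSucc + 1) - algebraMap R _ (u k)) * v q u a = 0 := by
    have e : L q u r (a k.castSucc + 1) - algebraMap R _ (u k) =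
        evalL q u r (X (lft a r k + 1) - C (u k)) := by
      rw [map_sub, evalL_X, evalL_C, lft, min_eq_left (by omega)]
    rw [e, v_eq, ← mul_assoc, ← mul_assoc, ← map_mul, mul_comm, ← piPoly_update]
    refine piPoly_vanish le_rfl (S := {j | k ≤ j}) (x := a k.castSucc + 1)
      (y := r - a k.castSucc)
      (by omega) (by omega) (by omega) (fun j hj => ?_) (fun j hj => ?_) (wElt_mem a r)
    · rcases eq_or_ne j k with rfl | hjk
      · rw [Function.update_self, lft, min_eq_left (by omega)]
      · have := a.mono' (Fin.succ_le_castSucc_iff.2 (lt_of_le_of_ne hj hjk.symm))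
        rw [Function.update_of_ne hjk, lft]
        omega
    · have := a.mono' (Fin.succ_le_castSucc_iff.2 (not_le.1 hj))
      rw [rgt]
      omega
  rw [sub_mul, sub_eq_zero] at h0
  rw [h0, Algebra.smul_def]

/-- Induction within a block of `𝐚'`, starting from the scalar action at its first point: the left
`T_i` of `L_{i+1}` is carried across `v_𝐚`, the hypothesis for `L_i` is applied, and the letter is
carried back. The intersection of index sets gives both memberships of (b) from one witness. -/
theorem v_mul_L (a : Lam m r) {i : ℕ} (h1 : 1 ≤ i) (h2 : i ≤ r) :
    ∃ h ∈ parab q u r (dualIdx a r ∩ {t | 1 ≤ t ∧ t < i}),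
      v q u a * L q u r i = v q u a * h := by
  induction i with
  | zero => omega
  | succ i ih =>
    obtain ⟨k, hk⟩ := a.exists_block (x := r - i) (by omega) (by omega)
    rw [mem_block] at hk
    have hle := a.le k.succ
    rcases Nat.eq_or_lt_of_le (by omega : r - a k.succ ≤ i) with h | h
    · refine ⟨_, Subalgebra.algebraMap_mem _ (u k), ?_⟩
      rw [← h, v_mul_L_first a (by omega), ← Algebra.commutes, Algebra.smul_def]
    · have hmem : i ∈ dualIdx a r := mem_dualIdx (k := k) h (by omega)
      obtain ⟨h', hh', e⟩ := ih hmem.1 (by omega)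
      have hT : T q u r i ∈ parab q u r (dualIdx a r ∩ {t | 1 ≤ t ∧ t < i + 1}) :=
        T_mem_parab ⟨hmem, hmem.1, Nat.lt_succ_self i⟩
      have hh'' : h' ∈ parab q u r (dualIdx a r ∩ {t | 1 ≤ t ∧ t < i + 1}) :=
        parab_mono (Set.inter_subset_inter_right _ fun t (ht : 1 ≤ t ∧ t < i) =>
          show 1 ≤ t ∧ t < i + 1 from ⟨ht.1, Nat.lt_succ_of_lt ht.2⟩) hh'
      refine ⟨_, Subalgebra.smul_mem _ (mul_mem (mul_mem hT hh'') hT) ((q⁻¹ : Rˣ) : R), ?_⟩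
      have hv := (v_mul_T (q := q) (u := u) a hmem).2
      rw [L_succ q u r hmem.1, mul_smul_comm, mul_smul_comm, ← mul_assoc, ← mul_assoc, hv,
        mul_assoc _ (v q u a), e, ← mul_assoc, ← hv]
      simp only [mul_assoc]

theorem L_mul_v (a : Lam m r) {i : ℕ} (h1 : 1 ≤ i) (h2 : i ≤ r) :
    ∃ h ∈ parab q u r (youngIdx a ∩ {t | 1 ≤ t ∧ t < i}),
      L q u r i * v q u a = h * v q u a := by
  induction i with
  | zero => omega
  | succ i ih =>
    obtain ⟨k, hk⟩ := a.exists_block h1 h2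
    rw [mem_block] at hk
    have hle := a.le k.succ
    rcases Nat.eq_or_lt_of_le (by omega : a k.castSucc ≤ i) with h | h
    · refine ⟨_, Subalgebra.algebraMap_mem _ (u k), ?_⟩
      rw [← h, L_first_mul_v a (by omega), Algebra.smul_def]
    · have hmem : i ∈ youngIdx a := mem_youngIdx (k := k) h hk.2
      obtain ⟨h', hh', e⟩ := ih hmem.1 (by omega)
      have hT : T q u r i ∈ parab q u r (youngIdx a ∩ {t | 1 ≤ t ∧ t < i + 1}) :=
        T_mem_parab ⟨hmem, hmem.1, Nat.lt_succ_self i⟩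
      have hh'' : h' ∈ parab q u r (youngIdx a ∩ {t | 1 ≤ t ∧ t < i + 1}) :=
        parab_mono (Set.inter_subset_inter_right _ fun t (ht : 1 ≤ t ∧ t < i) =>
          show 1 ≤ t ∧ t < i + 1 from ⟨ht.1, Nat.lt_succ_of_lt ht.2⟩) hh'
      refine ⟨_, Subalgebra.smul_mem _ (mul_mem (mul_mem hT hh'') hT) ((q⁻¹ : Rˣ) : R), ?_⟩
      obtain ⟨j, -, hv⟩ := T_mul_v (q := q) (u := u) a hmem
      rw [L_succ q u r hmem.1, smul_mul_assoc, smul_mul_assoc, mul_assoc, hv, mul_assoc,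
        ← mul_assoc _ (v q u a), e, mul_assoc h', ← hv]
      simp only [mul_assoc]

/-- `v_𝐚 ℋ(𝔖_{𝐚'})` is stable under left multiplication by polynomials in the `L_i`. -/
theorem evalL_mul_v (a : Lam m r) (f : MvPolynomial ℕ R) {h : Alg q u r}
    (hh : h ∈ parab q u r (dualIdx a r)) :
    ∃ h' ∈ parab q u r (dualIdx a r), evalL q u r f * (v q u a * h) = v q u a * h' := by
  induction f using MvPolynomial.induction_on generalizing h with
  | C x => exact ⟨_, Subalgebra.smul_mem _ hh x, by
      rw [evalL_C, ← Algebra.smul_def, mul_smul_comm]⟩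
  | add f g hf hg =>
    obtain ⟨h1, hh1, e1⟩ := hf hh
    obtain ⟨h2, hh2, e2⟩ := hg hh
    exact ⟨_, add_mem hh1 hh2, by rw [map_add, add_mul, e1, e2, mul_add]⟩
  | mul_X f i hf =>
    rw [map_mul, evalL_X]
    -- Variables with index outside `{1, …, r}` evaluate to zero.
    by_cases hi : 1 ≤ i ∧ i ≤ r
    · obtain ⟨h1, hh1, e1⟩ := L_mul_v (q := q) (u := u) a hi.1 hi.2
      obtain ⟨h2, hh2, e2⟩ := young_mul_v a (parab_mono Set.inter_subset_left hh1)
      obtain ⟨h3, hh3, e3⟩ := hf (mul_mem hh2 hh)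
      exact ⟨h3, hh3, by rw [← e3, ← mul_assoc (v q u a), ← e2, ← e1]; simp only [mul_assoc]⟩
    · refine ⟨0, zero_mem _, ?_⟩
      have : L q u r i = 0 := by
        rcases Nat.eq_zero_or_pos i with rfl | h
        · rfl
        · exact L_of_lt q u r (by omega)
      rw [this, mul_zero, zero_mul, mul_zero]

/-- To apply `L_i` after `v h1`, the factor `h1` is first carried to the left of `v`, so that `L_i`
meets `v` directly, and then carried back. -/
theorem v_mul_evalL (a : Lam m r) (f : MvPolynomial ℕ R) :
    ∃ h ∈ parab q u r (dualIdx a r), v q u a * evalL q u r f = v q u a * h := by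
  induction f using MvPolynomial.induction_on with
  | C x => exact ⟨_, Subalgebra.algebraMap_mem _ x, by rw [evalL_C]⟩
  | add f g hf hg =>
    obtain ⟨h1, hh1, e1⟩ := hf
    obtain ⟨h2, hh2, e2⟩ := hg
    exact ⟨_, add_mem hh1 hh2, by rw [map_add, mul_add, e1, e2, mul_add]⟩
  | mul_X f i hf =>
    obtain ⟨h1, hh1, e1⟩ := hf
    rw [map_mul, evalL_X, ← mul_assoc, e1]
    by_cases hi : 1 ≤ i ∧ i ≤ r
    · obtain ⟨h2, hh2, e2⟩ := v_mul_dual a hh1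
      obtain ⟨h3, hh3, e3⟩ := v_mul_L (q := q) (u := u) a hi.1 hi.2
      exact ⟨h1 * h3, mul_mem hh1 (parab_mono Set.inter_subset_left hh3),
        by rw [e2, mul_assoc, e3, ← mul_assoc, ← e2, mul_assoc]⟩
    · refine ⟨0, zero_mem _, ?_⟩
      have : L q u r i = 0 := by
        rcases Nat.eq_zero_or_pos i with rfl | h
        · rfl
        · exact L_of_lt q u r (by omega)
      rw [this, mul_zero, mul_zero]

theorem dualIdx_subset (a : Lam m r) : dualIdx a r ⊆ {i | 1 ≤ i ∧ i < r} :=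
  fun _ h => ⟨h.1, h.2.1⟩

theorem v_mul_eq (a : Lam m r) {h : Alg q u r} (hh : h ∈ parab q u r (dualIdx a r)) :
    v q u a * h = piA q u a * (wElt q u a r * h) * piTilde q u a.dual := by
  rw [v_eq, piA_eq, piTilde_eq, mul_assoc, ← (commute_rgt hh).eq]
  simp only [mul_assoc]

theorem piA_mul_mul_piTilde (a : Lam m r) {h : Alg q u r} (hh : h ∈ heckeA q u r r) :
    ∃ h' ∈ parab q u r (dualIdx a r), piA q u a * h * piTilde q u a.dual = v q u a * h' := by
  rw [v_eq, piA_eq, piTilde_eq]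
  exact lft_mul_mul_rgt le_rfl hh

/-- In a spanning product `f(L) h`, the factor `f(L)` commutes with `π_𝐚` and can be pulled out on
the left, where `evalL_mul_v` absorbs it. -/
theorem piA_mul_mul_piTilde' (a : Lam m r) (x : Alg q u r) :
    ∃ h ∈ parab q u r (dualIdx a r), piA q u a * x * piTilde q u a.dual = v q u a * h := by
  have hx := mem_span_evalL_mul q u r x
  induction hx using Submodule.span_induction with
  | zero => exact ⟨0, zero_mem _, by simp⟩
  | add x y _ _ h1 h2 =>
    obtain ⟨h1, hh1, e1⟩ := h1
    obtain ⟨h2, hh2, e2⟩ := h2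
    exact ⟨_, add_mem hh1 hh2, by rw [mul_add, add_mul, e1, e2, mul_add]⟩
  | smul c x _ h1 =>
    obtain ⟨h1, hh1, e1⟩ := h1
    exact ⟨_, Subalgebra.smul_mem _ hh1 c, by rw [mul_smul_comm, smul_mul_assoc, e1, mul_smul_comm]⟩
  | mem x hx =>
    obtain ⟨f, h, hh, rfl⟩ := hx
    obtain ⟨h1, hh1, e1⟩ := piA_mul_mul_piTilde a hh
    obtain ⟨h2, hh2, e2⟩ := evalL_mul_v a f hh1
    refine ⟨h2, hh2, ?_⟩
    rw [← e2, ← e1, ← mul_assoc, ← mul_assoc, ← mul_assoc, piA_eq, (commute_evalL q u r _ f).eq]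

theorem v_mul_mem (a : Lam m r) (x : Alg q u r) :
    ∃ h ∈ heckeA q u r r, v q u a * x = v q u a * h := by
  have hx := mem_span_evalL_mul q u r x
  induction hx using Submodule.span_induction with
  | zero => exact ⟨0, zero_mem _, rfl⟩
  | add x y _ _ h1 h2 =>
    obtain ⟨h1, hh1, e1⟩ := h1
    obtain ⟨h2, hh2, e2⟩ := h2
    exact ⟨_, add_mem hh1 hh2, by rw [mul_add, e1, e2, mul_add]⟩
  | smul c x _ h1 =>
    obtain ⟨h1, hh1, e1⟩ := h1
    exact ⟨_, Subalgebra.smul_mem _ hh1 c, by rw [mul_smul_comm, e1, mul_smul_comm]⟩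
  | mem x hx =>
    obtain ⟨f, h, hh, rfl⟩ := hx
    obtain ⟨h1, hh1, e1⟩ := v_mul_evalL (q := q) (u := u) a f
    exact ⟨h1 * h, mul_mem (parab_mono (dualIdx_subset a) hh1) hh, by
      rw [← mul_assoc, e1, mul_assoc]⟩

theorem image_piA_piTilde (a : Lam m r) :
    (fun h : Alg q u r => piA q u a * h * piTilde q u a.dual) '' (heckeA q u r r : Set _) =
      (fun h => v q u a * h) '' (parab q u r (dualIdx a r) : Set _) := by
  ext y
  constructor
  · rintro ⟨h, hh, rfl⟩
    obtain ⟨h', hh', e⟩ := piA_mul_mul_piTilde a hh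
    exact ⟨h', hh', e.symm⟩
  · rintro ⟨h, hh, rfl⟩
    exact ⟨_, mul_mem (wElt_mem a r) (parab_mono (dualIdx_subset a) hh), (v_mul_eq a hh).symm⟩

end Theorem

end ArikiKoike
-- Assembly of (a)–(d)
theorem mainTheorem11 {R : Type*} [CommRing R] {m : ℕ} (hm : 0 < m) (r : ℕ) (q : Rˣ)
    (u : Fin m → R) (a : ArikiKoike.Lam m r) :
    -- (a)
    ((fun h : ArikiKoike.Alg q u r => ArikiKoike.piA q u a * h * ArikiKoike.piTilde q u a.dual) ''
          (ArikiKoike.hecke q u r (ArikiKoike.sym r) : Set (ArikiKoike.Alg q u r)) =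
        (fun h : ArikiKoike.Alg q u r => ArikiKoike.v q u a * h) ''
          (ArikiKoike.hecke q u r (ArikiKoike.young a.dual) : Set (ArikiKoike.Alg q u r)) ∧
      (fun h : ArikiKoike.Alg q u r => ArikiKoike.v q u a * h) ''
          (ArikiKoike.hecke q u r (ArikiKoike.young a.dual) : Set (ArikiKoike.Alg q u r)) =
        (fun h => h * ArikiKoike.v q u a) ''
          (ArikiKoike.hecke q u r (ArikiKoike.young a) : Set (ArikiKoike.Alg q u r)) ∧
      ∀ i, 1 ≤ i → i < r → ArikiKoike.s i ∈ ArikiKoike.young a.dual →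
        ArikiKoike.v q u a * ArikiKoike.T q u r i =
          ArikiKoike.T q u r ((ArikiKoike.wPerm a : Equiv.Perm ℕ)⁻¹ i) * ArikiKoike.v q u a) ∧
    -- (b)
    ((∀ i, 1 ≤ i → i ≤ r →
        ArikiKoike.v q u a * ArikiKoike.L q u r i ∈
            ((fun h : ArikiKoike.Alg q u r => ArikiKoike.v q u a * h) ''
              (ArikiKoike.hecke q u r (ArikiKoike.sym i) : Set (ArikiKoike.Alg q u r))) ∩
            ((fun h : ArikiKoike.Alg q u r => ArikiKoike.v q u a * h) ''
              (ArikiKoike.hecke q u r (ArikiKoike.young a.dual) : Set (ArikiKoike.Alg q u r))) ∧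
        ArikiKoike.L q u r i * ArikiKoike.v q u a ∈
            ((fun h => h * ArikiKoike.v q u a) ''
              (ArikiKoike.hecke q u r (ArikiKoike.sym i) : Set (ArikiKoike.Alg q u r))) ∩
            ((fun h => h * ArikiKoike.v q u a) ''
              (ArikiKoike.hecke q u r (ArikiKoike.young a) : Set (ArikiKoike.Alg q u r)))) ∧
      ∀ j : Fin m, a j.castSucc < a j.succ →
        ArikiKoike.v q u a * ArikiKoike.L q u r (r - a j.succ + 1) =
          u j • ArikiKoike.v q u a) ∧
    -- (c)
    Set.range (fun h : ArikiKoike.Alg q u r =>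
        ArikiKoike.piA q u a * h * ArikiKoike.piTilde q u a.dual) =
      (fun h : ArikiKoike.Alg q u r => ArikiKoike.piA q u a * h * ArikiKoike.piTilde q u a.dual) ''
        (ArikiKoike.hecke q u r (ArikiKoike.sym r) : Set (ArikiKoike.Alg q u r)) ∧
    -- (d)
    Set.range (fun h : ArikiKoike.Alg q u r => ArikiKoike.v q u a * h) =
      (fun h : ArikiKoike.Alg q u r => ArikiKoike.v q u a * h) ''
        (ArikiKoike.hecke q u r (ArikiKoike.sym r) : Set (ArikiKoike.Alg q u r)) := by
  rw [ArikiKoike.hecke_sym le_rfl, ArikiKoike.hecke_young_dual, ArikiKoike.hecke_young, ArikiKoike.image_piA_piTilde]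
  refine ⟨⟨rfl, ?_, fun i h1 h2 h3 => ?_⟩, ⟨fun i h1 h2 => ?_, fun j hj => ArikiKoike.v_mul_L_first a hj⟩,
    ?_, ?_⟩
  · ext y
    constructor
    · rintro ⟨h, hh, rfl⟩
      obtain ⟨h', hh', e⟩ := ArikiKoike.v_mul_dual a hh
      exact ⟨h', hh', e.symm⟩
    · rintro ⟨h, hh, rfl⟩
      obtain ⟨h', hh', e⟩ := ArikiKoike.young_mul_v a hh
      exact ⟨h', hh', e.symm⟩
  · refine (ArikiKoike.v_mul_T a ?_).2
    rw [ArikiKoike.dualIdx_eq]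
    exact ⟨h1, h2, (ArikiKoike.s_mem_young_iff _ h1 h2).1 h3⟩
  · rw [ArikiKoike.hecke_sym h2]
    obtain ⟨x, hx, e1⟩ := ArikiKoike.v_mul_L (q := q) (u := u) a h1 h2
    obtain ⟨y, hy, e2⟩ := ArikiKoike.L_mul_v (q := q) (u := u) a h1 h2
    exact ⟨⟨⟨x, ArikiKoike.parab_mono Set.inter_subset_right hx, e1.symm⟩,
        ⟨x, ArikiKoike.parab_mono Set.inter_subset_left hx, e1.symm⟩⟩,
      ⟨y, ArikiKoike.parab_mono Set.inter_subset_right hy, e2.symm⟩,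
      ⟨y, ArikiKoike.parab_mono Set.inter_subset_left hy, e2.symm⟩⟩
  · refine Set.Subset.antisymm ?_ ?_
    · rintro _ ⟨x, rfl⟩
      obtain ⟨h, hh, e⟩ := ArikiKoike.piA_mul_mul_piTilde' (q := q) (u := u) a x
      exact ⟨h, hh, e.symm⟩
    · rw [← ArikiKoike.image_piA_piTilde]
      exact Set.image_subset_range _ _
  · refine Set.Subset.antisymm ?_ (Set.image_subset_range _ _)
    rintro _ ⟨x, rfl⟩
    obtain ⟨h, hh, e⟩ := ArikiKoike.v_mul_mem (q := q) (u := u) a x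
    exact ⟨h, hh, e.symm⟩
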